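/- Let $H\in(0,1)$, $d\ge 1$, $S^1=\mathbb R/2\pi\mathbb Z$ with its arc-length distance $|x-y|$, and let $(q_n)_{n\ge0}$ be non-negative reals for which there are constants $c,C>0$ and $\alpha\in(0,1]$, $\alpha\ne 2H$, such that for all $n$ large enough $$c\,n^{4H-2\alpha-1}\le q_n\le C\,n^{4H-2\alpha-1}. \tag{hq}$$ Let $\beta_{i,n},\beta'_{i,n}$ ($1\le i\le d$, $n\ge 0$) be independent standard one-dimensional fractional Brownian motions with Hurst parameter $H$ (centered Gaussian processes with covariance $\tfrac12(t^{2H}+s^{2H}-|t-s|^{2H})$), and let $u=(u_1,\dots,u_d)$ be the mild solution on $S^1$ of the stochastic heat equation with this noise and zero initial condition, $$u_i(t,x)=\sum_{n\ge0}\sqrt{q_n}\Big(\cos(nx)\int_0^te^{-n^2(t-s)}\beta_{i,n}(ds)+\sin(nx)\int_0^te^{-n^2(t-s)}\beta'_{i,n}(ds)\Big),$$ with Wiener integrals and convergence in $L^2(\Omega)$. Fix $0<t_0\le t\le T$. Then the canonical metric of $u(t,\cdot)$ is homogeneous, that is, $\big(\mathrm E\|u(t,x)-u(t,y)\|^2\big)^{1/2}=\delta_t(x-y)$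 for a function $\delta_t$ on $S^1$, and: 1. For all $r>0$ close enough to $0$, $\ \sqrt{k_\alpha\, c\; c(t_0,T,H)}\;r^\alpha\le\delta_t(r)$, and, if $\alpha<1$, also $\ \delta_t(r)\le\sqrt{K_\alpha\, C\; C(t_0,T,H)}\;r^\alpha$. Here $k_\alpha,K_\alpha>0$ depend only on $\alpha$, and $c(t_0,T,H),C(t_0,T,H)>0$ depend only on $t_0,T,H$ (and the fixed dimension $d$). 2. $u(t,\cdot)$ has a modification (which may be taken to be $u(t,\cdot)$ itself if that field is separable) whose paths are almost surely $\beta$-Hölder continuous for every $\beta\in(0,\alpha)$ and, if $\alpha<1$, have $r\mapsto r^\alpha\log^{1/2}(1/r)$ as almost sure uniform modulus of continuity up to a non-random constant: for some non-random $K$, almost surely there is $\varepsilon>0$ with $\|u(t,x)-u(t,y)\|\le K|x-y|^\alpha\log^{1/2}(1/|x-y|)$ whenever $0<|x-y|<\varepsilon$. -/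

import Mathlib

open MeasureTheory ProbabilityTheory Filter Topology
open scoped NNReal ENNReal

/-- The covariance function of standard fractional Brownian motion with Hurst parameter `H`. -/
noncomputable def fbmCov (H : ℝ) (s t : ℝ≥0) : ℝ :=
  ((t : ℝ) ^ (2 * H) + (s : ℝ) ^ (2 * H) - |(t : ℝ) - (s : ℝ)| ^ (2 * H)) / 2

/-- `B` is a one-dimensional standard fractional Brownian motion with Hurst parameter `H`:
a centered Gaussian process on `ℝ≥0` with covariance `fbmCov H`. -/
structure IsFBM {Ω : Type*} [MeasurableSpace Ω] (P : Measure Ω) (H : ℝ)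
    (B : ℝ≥0 → Ω → ℝ) : Prop where
  measurable : ∀ t, Measurable (B t)
  gaussian : IsGaussianProcess B P
  mean_zero : ∀ t, ∫ ω, B t ω ∂P = 0
  cov : ∀ s t, ∫ ω, B s ω * B t ω ∂P = fbmCov H s t

/-- The driving noise: a doubly indexed family of independent fractional Brownian motions.
`W i n 0` and `W i n 1` multiply the Fourier modes `cos (n x)` and `sin (n x)` of the `i`-th
component of the noise. -/
structure IsFBMFamily {Ω : Type*} [MeasurableSpace Ω] (P : Measure Ω) (H : ℝ) {d : ℕ}
    (W : Fin d → ℕ → Fin 2 → ℝ≥0 → Ω → ℝ) : Prop where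
  fbm : ∀ i n j, IsFBM P H (W i n j)
  indep : iIndepFun (fun (a : Fin d × ℕ × Fin 2) (ω : Ω) (t : ℝ≥0) => W a.1 a.2.1 a.2.2 t ω) P

/-- `X` is the Wiener integral `∫₀ᵗ φ(s) B(ds)` of the deterministic integrand `φ`: the limit in
`L²(P)` of the integrals `∑ φ(ξ_k) (B(s_{k+1}) - B(s_k))` of the step functions
`∑ φ(ξ_k) 1_{(s_k, s_{k+1}]}`, as the mesh of the partition `0 = s_0 ≤ ⋯ ≤ s_N = t` with tags
`ξ_k ∈ [s_k, s_{k+1}]` tends to zero. (The integral of a step function is its image under the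
isometry `1_{(0, s]} ↦ B(s)`. For continuously differentiable `φ`, the only integrands used here,
these step functions converge to `φ` in the Hilbert space of integrands of `B`.) -/
def IsWienerIntegral {Ω : Type*} [MeasurableSpace Ω] (P : Measure Ω) (B : ℝ≥0 → Ω → ℝ)
    (φ : ℝ≥0 → ℝ) (t : ℝ≥0) (X : Ω → ℝ) : Prop :=
  MemLp X 2 P ∧
    ∀ ε : ℝ, 0 < ε → ∃ η : ℝ≥0, 0 < η ∧
      ∀ (N : ℕ) (s ξ : ℕ → ℝ≥0), s 0 = 0 → s N = t →
        (∀ k < N, s k ≤ ξ k ∧ ξ k ≤ s (k + 1) ∧ s (k + 1) ≤ s k + η) →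
        eLpNorm (fun ω => X ω - ∑ k ∈ Finset.range N, φ (ξ k) * (B (s (k + 1)) ω - B (s k) ω)) 2 P
          ≤ ENNReal.ofReal ε

/-- `u` is the evolution (mild) solution on the circle `S¹ = ℝ / 2πℤ`, with zero initial condition,
of the stochastic heat equation with noise coefficients `q`: its `i`-th component is
`∑ₙ √qₙ (cos (n x) ∫₀ᵗ e^{-n²(t-s)} W i n 0 (ds) + sin (n x) ∫₀ᵗ e^{-n²(t-s)} W i n 1 (ds))`,
the series converging in `L²(P)` for all `t` and `x`. -/
def IsMildSolution {Ω : Type*} [MeasurableSpace Ω] (P : Measure Ω) (q : ℕ → ℝ) {d : ℕ}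
    (W : Fin d → ℕ → Fin 2 → ℝ≥0 → Ω → ℝ)
    (u : ℝ≥0 → Real.Angle → Ω → EuclideanSpace ℝ (Fin d)) : Prop :=
  (∀ t x, MemLp (u t x) 2 P) ∧
  ∃ I : Fin d → ℕ → Fin 2 → ℝ≥0 → Ω → ℝ,
    (∀ i n j (t : ℝ≥0), IsWienerIntegral P (W i n j)
      (fun s : ℝ≥0 => Real.exp (-(n : ℝ) ^ 2 * ((t : ℝ) - (s : ℝ)))) t (I i n j t)) ∧
    ∀ (t : ℝ≥0) (x : Real.Angle) (i : Fin d), Tendsto (fun N : ℕ => eLpNorm (fun ω => u t x ω i -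
        ∑ n ∈ Finset.range N, √(q n) * (Real.Angle.cos (n • x) * I i n 0 t ω
          + Real.Angle.sin (n • x) * I i n 1 t ω)) 2 P) atTop (𝓝 0)

/-- The growth hypothesis on the Fourier coefficients `q` of the spatial covariance of the noise,
with constants `c`, `C` and exponent `α`. -/
structure NoiseHypothesis (H : ℝ) (q : ℕ → ℝ) (c C α : ℝ) : Prop where
  nonneg : ∀ n, 0 ≤ q n
  c_pos : 0 < c
  C_pos : 0 < C
  α_pos : 0 < α
  α_le_one : α ≤ 1
  α_ne : α ≠ 2 * H
  bounds : ∀ᶠ n : ℕ in atTop, c * (n : ℝ) ^ (4 * H - 2 * α - 1) ≤ q n ∧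
    q n ≤ C * (n : ℝ) ^ (4 * H - 2 * α - 1)

/-- The canonical metric `(E ‖Y x - Y y‖²)^{1/2}` of a random field `Y` on the circle. -/
noncomputable def canonicalMetric {Ω E : Type*} [MeasurableSpace Ω] [NormedAddCommGroup E]
    (P : Measure Ω) (Y : Real.Angle → Ω → E) (x y : Real.Angle) : ℝ :=
  √(∫ ω, ‖Y x ω - Y y ω‖ ^ 2 ∂P)

/-- A random field on the circle is separable if, almost surely, its graph lies in the closure of
its graph over a fixed countable dense set. -/
def IsSeparableField {Ω E : Type*} [MeasurableSpace Ω] [NormedAddCommGroup E]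
    (P : Measure Ω) (Y : Real.Angle → Ω → E) : Prop :=
  ∃ D : Set Real.Angle, D.Countable ∧ Dense D ∧
    ∀ᵐ ω ∂P, ∀ x, (x, Y x ω) ∈ closure ((fun y => (y, Y y ω)) '' D)

/-- Almost surely, the paths of `Y` are `β`-Hölder continuous on the circle for every
`β ∈ (0, α)`. -/
def HolderBelow {Ω E : Type*} [MeasurableSpace Ω] [NormedAddCommGroup E]
    (P : Measure Ω) (Y : Real.Angle → Ω → E) (α : ℝ) : Prop :=
  ∀ᵐ ω ∂P, ∀ β : ℝ, 0 < β → β < α → ∃ M : ℝ, ∀ x y, ‖Y x ω - Y y ω‖ ≤ M * ‖x - y‖ ^ β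

/-- Up to a non-random constant `K`, the function `w` is an almost sure uniform modulus of
continuity of `Y`. -/
def HasUniformModulus {Ω E : Type*} [MeasurableSpace Ω] [NormedAddCommGroup E]
    (P : Measure Ω) (Y : Real.Angle → Ω → E) (w : ℝ → ℝ) : Prop :=
  ∃ K : ℝ, 0 < K ∧ ∀ᵐ ω ∂P, ∃ ε : ℝ, 0 < ε ∧
    ∀ x y, 0 < ‖x - y‖ → ‖x - y‖ < ε → ‖Y x ω - Y y ω‖ ≤ K * w ‖x - y‖

/-!
The increments of the solution at time `t` are centred Gaussian, and by independence of the modes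
each of their `d` coordinates has variance `∑ 2 qₙ Vₙ (1 - cos (n (x - y)))`, where `Vₙ` is the
variance of `∫₀ᵗ e^{-n² (t - s)} B(ds)`. Everything rests on three estimates.

*The variance `Vₙ` is of order `n^(-4H)`.* By Abel summation a Riemann sum of the Wiener integral
is a combination, with non-negative weights of total mass at most `1`, of increments `B t - B s`,
whose covariances are `fbmCov H (t - r) (t - s)`. The weights approximate the law of an
exponential time of rate `l = n²`, cut off at `t`. The bound
`min r s ^ (2H) / 2 ≤ fbmCov H r s ≤ (r ^ (2H) + s ^ (2H)) / 2` then gives both inequalities, for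
all `H` in `(0, 1)` at once and without computing any integral (`le_riemannVar`,
`riemannVar_le`); they pass to the limit in `L²`.

*The series.* With weights of order `n^(-2α-1)`, the sum of `1 - cos (n r)` is at least of order
`r^(2α)`, because of a block of `n` between about `1 / r` and `2 / r` alone, and for `α < 1` at
most of that order, by splitting at `n ≈ 1 / r` (`lowerConst_mul_rpow_le_sum`,
`sum_rpow_mul_one_sub_cos_le`). Finitely many terms do not matter, since they contribute `O(r²)`.

*Chaining.* A Gaussian variable is sub-Gaussian with its variance as proxy, and so is an `L²`
limit of such variables (`hasSubgaussianMGF_of_tendsto_eLpNorm`). If the increments have proxy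
`A ‖x - y‖^(2a)`, then by Borel-Cantelli almost surely all dyadic increments of high level `m` are
at most a multiple of `√m 2^(-m a)`, and summation over the levels bounds the modulus of continuity
of the limit along dyadic points by a multiple of `r^a √(log (1 / r))`
(`exists_norm_dyadicLimit_sub_le`, `SubgaussianIncrements.hasUniformModulus_dyadicVersion`). This
limit is a modification of the field. Taking `a = α` if `α < 1`, and all `a < α` in any case,
gives the modulus and the Hölder property. A separable field agrees almost surely everywhere with
a continuous modification (`IsSeparableField.ae_forall_eq`), and thus inherits both.
-/

/-! ### Asymptotics of trigonometric series with power weights -/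

theorem one_sub_cos_le_sq_div_two (x : ℝ) : 1 - Real.cos x ≤ x ^ 2 / 2 := by
  have := Real.one_sub_sq_div_two_le_cos (x := x)
  linarith

/-- Discrete derivative of `x ^ p`, which makes the sums of `n ^ (p - 1)` telescope. -/
theorem min_mul_rpow_sub_one_le {p x : ℝ} (hp : 0 < p) (hx : 1 ≤ x) :
    min p 1 * x ^ (p - 1) ≤ x ^ p - (x - 1) ^ p := by
  have hx0 : 0 < x := by linarith
  have hinv : x⁻¹ ≤ 1 := inv_le_one_of_one_le₀ hx
  have hinv0 : 0 < x⁻¹ := by positivity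
  have h1 : (1 + -x⁻¹) ^ (min p 1) ≤ 1 + min p 1 * (-x⁻¹) :=
    rpow_one_add_le_one_add_mul_self (by linarith) (by positivity) (min_le_right _ _)
  have h2 : (1 + -x⁻¹) ^ p ≤ (1 + -x⁻¹) ^ (min p 1) := by
    rcases eq_or_lt_of_le (show 0 ≤ 1 + -x⁻¹ by linarith) with h | h
    · rw [← h, Real.zero_rpow hp.ne', Real.zero_rpow (by positivity)]
    · exact Real.rpow_le_rpow_of_exponent_ge h (by linarith) (min_le_left _ _)
  have h3 : (x - 1) ^ p = x ^ p * (1 + -x⁻¹) ^ p := by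
    rw [← Real.mul_rpow hx0.le (by linarith)]
    congr 1
    field_simp
    ring
  have h4 : x ^ (p - 1) = x ^ p * x⁻¹ := by
    rw [Real.rpow_sub_one hx0.ne', div_eq_mul_inv]
  rw [h3, h4]
  have h5 : 0 < x ^ p := by positivity
  nlinarith [mul_le_mul_of_nonneg_left (h2.trans h1) h5.le]

/-- Discrete derivative of `x ^ (-b)`, which makes the tails of `n ^ (-b - 1)` telescope. -/
theorem mul_rpow_neg_sub_one_le {b x : ℝ} (hb : 0 < b) (hx : 1 < x) :
    b * x ^ (-b - 1) ≤ (x - 1) ^ (-b) - x ^ (-b) := by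
  have hx0 : 0 < x := by linarith
  have hinv : x⁻¹ < 1 := inv_lt_one_of_one_lt₀ hx
  have h1 : 1 + b * x⁻¹ ≤ (1 - x⁻¹) ^ (-b) := by
    have h2 : (1 - x⁻¹) ^ b ≤ Real.exp (-(b * x⁻¹)) := by
      have := Real.rpow_le_rpow (by linarith) (Real.one_sub_le_exp_neg x⁻¹) hb.le
      rwa [← Real.exp_mul, show -x⁻¹ * b = -(b * x⁻¹) by ring] at this
    have h3 : 0 < (1 - x⁻¹) ^ b := Real.rpow_pos_of_pos (by linarith) _
    rw [Real.rpow_neg (by linarith)]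
    calc 1 + b * x⁻¹ ≤ Real.exp (b * x⁻¹) := by
          have := Real.add_one_le_exp (b * x⁻¹); linarith
      _ = (Real.exp (-(b * x⁻¹)))⁻¹ := by rw [Real.exp_neg, inv_inv]
      _ ≤ _ := inv_anti₀ h3 h2
  have h3 : (x - 1) ^ (-b) = x ^ (-b) * (1 - x⁻¹) ^ (-b) := by
    rw [← Real.mul_rpow hx0.le (by linarith)]
    congr 1
    field_simp
  have h4 : x ^ (-b - 1) = x ^ (-b) * x⁻¹ := by
    rw [Real.rpow_sub_one hx0.ne', div_eq_mul_inv]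
  rw [h3, h4]
  have h5 : 0 < x ^ (-b) := by positivity
  nlinarith [mul_le_mul_of_nonneg_left h1 h5.le]

theorem sum_Ico_rpow_sub_one_le {p : ℝ} (hp : 0 < p) (N : ℕ) :
    min p 1 * ∑ n ∈ Finset.Ico 1 (N + 1), (n : ℝ) ^ (p - 1) ≤ (N : ℝ) ^ p := by
  induction N with
  | zero => simp [Real.zero_rpow hp.ne']
  | succ N ih =>
    rw [Finset.sum_Ico_succ_top (by omega), mul_add]
    have := min_mul_rpow_sub_one_le hp (x := ((N + 1 : ℕ) : ℝ))
      (by push_cast; linarith [N.cast_nonneg (α := ℝ)])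
    have h2 : ((N + 1 : ℕ) : ℝ) - 1 = N := by push_cast; ring
    rw [h2] at this
    linarith

theorem sum_Ico_rpow_neg_le {b : ℝ} (hb : 0 < b) {N : ℕ} (hN : 1 ≤ N) (M : ℕ) :
    b * ∑ n ∈ Finset.Ico (N + 1) (N + 1 + M), (n : ℝ) ^ (-b - 1) ≤
      (N : ℝ) ^ (-b) - ((N + M : ℕ) : ℝ) ^ (-b) := by
  induction M with
  | zero => simp
  | succ M ih =>
    rw [← add_assoc (N + 1) M 1, Finset.sum_Ico_succ_top (by omega), mul_add]
    have hN' : (1 : ℝ) ≤ N := by exact_mod_cast hN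
    have := mul_rpow_neg_sub_one_le hb (x := ((N + 1 + M : ℕ) : ℝ))
      (by push_cast; linarith [M.cast_nonneg (α := ℝ)])
    have h2 : ((N + 1 + M : ℕ) : ℝ) - 1 = (N + M : ℕ) := by push_cast; ring
    rw [h2] at this
    have h3 : N + (M + 1) = N + 1 + M := by ring
    rw [h3]
    linarith

/-- The constant of the upper bound `∑ n^(-2a-1) (1 - cos (n r)) ≤ upperConst a * r^(2a)`. -/
noncomputable def upperConst (a : ℝ) : ℝ := 2 / min (2 - 2 * a) 1 + 1 / a

/-- Split at `n ≈ 1 / r`, with `1 - cos (n r) ≤ (n r)² / 2` below and `1 - cos (n r) ≤ 2` above. -/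
theorem sum_rpow_mul_one_sub_cos_le {a : ℝ} (ha : 0 < a) (ha1 : a < 1) {r : ℝ} (hr : 0 < r)
    (hr1 : r ≤ 1) (M : ℕ) :
    ∑ n ∈ Finset.Ico 1 M, (n : ℝ) ^ (-(2 * a) - 1) * (1 - Real.cos (n * r)) ≤
      upperConst a * r ^ (2 * a) := by
  set N := ⌈1 / r⌉₊ with hNdef
  have hN1 : 1 / r ≤ N := Nat.le_ceil _
  have hN2 : (N : ℝ) ≤ 2 / r := by
    have := (Nat.ceil_lt_add_one (show 0 ≤ 1 / r by positivity)).le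
    have h1 : 1 ≤ 1 / r := by rw [le_div_iff₀ hr]; linarith
    calc (N : ℝ) ≤ 1 / r + 1 := this
      _ ≤ 1 / r + 1 / r := by linarith
      _ = 2 / r := by ring
  have hN : 1 ≤ N := Nat.one_le_iff_ne_zero.mpr (by
    intro h; rw [h] at hN1; have : 0 < 1 / r := by positivity
    simp at hN1; linarith)
  have hNpos : (0 : ℝ) < N := by exact_mod_cast hN
  set p := 2 - 2 * a with hp
  have hp0 : 0 < p := by linarith
  have hm : 0 < min p 1 := by positivity
  have hnn : ∀ n : ℕ, 0 ≤ (n : ℝ) ^ (-(2 * a) - 1) * (1 - Real.cos (n * r)) := fun n =>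
    mul_nonneg (by positivity) (by linarith [Real.cos_le_one (n * r)])
  have hA : ∑ n ∈ Finset.Ico 1 (N + 1), (n : ℝ) ^ (-(2 * a) - 1) * (1 - Real.cos (n * r)) ≤
      2 / min p 1 * r ^ (2 * a) := by
    have h1 : ∑ n ∈ Finset.Ico 1 (N + 1), (n : ℝ) ^ (-(2 * a) - 1) * (1 - Real.cos (n * r)) ≤
        r ^ 2 / 2 * ∑ n ∈ Finset.Ico 1 (N + 1), (n : ℝ) ^ (p - 1) := by
      rw [Finset.mul_sum]
      refine Finset.sum_le_sum fun n hn => ?_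
      have hn1 : (0 : ℝ) < n := by
        have := (Finset.mem_Ico.mp hn).1
        exact_mod_cast this
      have h2 : (n : ℝ) ^ (p - 1) = (n : ℝ) ^ (-(2 * a) - 1) * (n : ℝ) ^ 2 := by
        rw [← Real.rpow_natCast, ← Real.rpow_add hn1]
        congr 1; rw [hp]; push_cast; ring
      rw [h2]
      calc _ ≤ (n : ℝ) ^ (-(2 * a) - 1) * ((n * r) ^ 2 / 2) :=
            mul_le_mul_of_nonneg_left (one_sub_cos_le_sq_div_two _) (by positivity)
        _ = _ := by ring
    have h3 : ∑ n ∈ Finset.Ico 1 (N + 1), (n : ℝ) ^ (p - 1) ≤ (2 / r) ^ p / min p 1 := by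
      rw [le_div_iff₀ hm, mul_comm]
      exact (sum_Ico_rpow_sub_one_le hp0 N).trans
        (Real.rpow_le_rpow hNpos.le hN2 hp0.le)
    have h4 : (2 / r) ^ p ≤ 4 * r ^ (-p) := by
      rw [Real.div_rpow (by norm_num) hr.le, Real.rpow_neg hr.le, div_eq_mul_inv]
      have : (2 : ℝ) ^ p ≤ 2 ^ (2 : ℝ) :=
        Real.rpow_le_rpow_of_exponent_le (by norm_num) (by linarith)
      have h5 : (2 : ℝ) ^ (2 : ℝ) = 4 := by norm_num
      rw [h5] at this
      exact mul_le_mul_of_nonneg_right this (by positivity)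
    have h6 : r ^ 2 * r ^ (-p) = r ^ (2 * a) := by
      rw [← Real.rpow_natCast, ← Real.rpow_add hr]
      congr 1; rw [hp]; push_cast; ring
    calc _ ≤ r ^ 2 / 2 * ((2 / r) ^ p / min p 1) := h1.trans (by gcongr)
      _ ≤ r ^ 2 / 2 * (4 * r ^ (-p) / min p 1) := by gcongr
      _ = 2 / min p 1 * (r ^ 2 * r ^ (-p)) := by ring
      _ = _ := by rw [h6]
  have hB : ∑ n ∈ Finset.Ico (N + 1) (N + 1 + M),
      (n : ℝ) ^ (-(2 * a) - 1) * (1 - Real.cos (n * r)) ≤ 1 / a * r ^ (2 * a) := by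
    have h1 : ∑ n ∈ Finset.Ico (N + 1) (N + 1 + M),
        (n : ℝ) ^ (-(2 * a) - 1) * (1 - Real.cos (n * r)) ≤
        2 * ∑ n ∈ Finset.Ico (N + 1) (N + 1 + M), (n : ℝ) ^ (-(2 * a) - 1) := by
      rw [Finset.mul_sum]
      refine Finset.sum_le_sum fun n _ => ?_
      rw [mul_comm]
      exact mul_le_mul_of_nonneg_right (by linarith [Real.neg_one_le_cos (n * r)]) (by positivity)
    have h2 := sum_Ico_rpow_neg_le (b := 2 * a) (by linarith) hN M
    have h3 : (0 : ℝ) ≤ ((N + M : ℕ) : ℝ) ^ (-(2 * a)) := by positivity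
    have h4 : (N : ℝ) ^ (-(2 * a)) ≤ r ^ (2 * a) := by
      calc (N : ℝ) ^ (-(2 * a)) ≤ (1 / r) ^ (-(2 * a)) :=
            Real.rpow_le_rpow_of_nonpos (by positivity) hN1 (by linarith)
        _ = _ := by rw [one_div, Real.inv_rpow hr.le, Real.rpow_neg hr.le, inv_inv]
    calc _ ≤ _ := h1
      _ = (1 / a) * (2 * a * ∑ n ∈ Finset.Ico (N + 1) (N + 1 + M), (n : ℝ) ^ (-(2 * a) - 1)) := by
          field_simp
      _ ≤ _ := by gcongr; linarith
  calc _ ≤ ∑ n ∈ Finset.Ico 1 (N + 1 + M), (n : ℝ) ^ (-(2 * a) - 1) * (1 - Real.cos (n * r)) :=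
        Finset.sum_le_sum_of_subset_of_nonneg (Finset.Ico_subset_Ico_right (by omega))
          fun n _ _ => hnn n
    _ = _ := (Finset.sum_Ico_consecutive _ (show 1 ≤ N + 1 by omega) (by omega)).symm
    _ ≤ _ := by rw [upperConst, add_mul]; exact add_le_add hA hB

/-- The constant of the lower bound `lowerConst a * r^(2a) ≤ ∑ n^(-2a-1) (1 - cos (n r))`. -/
noncomputable def lowerConst (a : ℝ) : ℝ := 2 / Real.pi ^ 2 * 2 ^ (-(2 * a) - 1) * 2 ^ (-(2 * a))

/-- The block `N ≤ n < 2 N` with `N = ⌈1 / r⌉` alone has the full order of magnitude: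
there `1 - cos (n r)` is bounded below. -/
theorem lowerConst_mul_rpow_le_sum {a : ℝ} (ha : 0 < a) {r : ℝ} (hr : 0 < r) (hr1 : r ≤ 1 / 2) :
    lowerConst a * r ^ (2 * a) ≤ ∑ n ∈ Finset.Ico ⌈1 / r⌉₊ (2 * ⌈1 / r⌉₊),
      (n : ℝ) ^ (-(2 * a) - 1) * (1 - Real.cos (n * r)) := by
  set N := ⌈1 / r⌉₊ with hNdef
  have hN1 : 1 / r ≤ N := Nat.le_ceil _
  have hN3 : (N : ℝ) ≤ 1 / r + 1 := (Nat.ceil_lt_add_one (show 0 ≤ 1 / r by positivity)).le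
  have hN2 : (N : ℝ) ≤ 2 / r := by
    have h1 : 1 ≤ 1 / r := by rw [le_div_iff₀ hr]; linarith
    calc (N : ℝ) ≤ 1 / r + 1 := hN3
      _ ≤ 1 / r + 1 / r := by linarith
      _ = 2 / r := by ring
  have hNpos : (0 : ℝ) < N := lt_of_lt_of_le (by positivity) hN1
  have hNr : 1 ≤ N * r := by rwa [div_le_iff₀ hr] at hN1
  have hNr2 : 2 * (N * r) ≤ 3 := by
    have : N * r ≤ (1 / r + 1) * r := by gcongr
    have h2 : (1 / r + 1) * r = 1 + r := by field_simp
    linarith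
  have key : ∀ n ∈ Finset.Ico N (2 * N), (2 * N : ℝ) ^ (-(2 * a) - 1) * (2 / Real.pi ^ 2) ≤
      (n : ℝ) ^ (-(2 * a) - 1) * (1 - Real.cos (n * r)) := by
    intro n hn
    obtain ⟨h1, h2⟩ := Finset.mem_Ico.mp hn
    have h1' : (N : ℝ) ≤ n := by exact_mod_cast h1
    have h2' : (n : ℝ) ≤ 2 * N := by exact_mod_cast h2.le
    have h3 : 1 ≤ n * r := hNr.trans (by gcongr)
    have h4 : n * r ≤ 3 := by
      refine le_trans ?_ hNr2
      rw [← mul_assoc]; gcongr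
    have h5 : Real.cos (n * r) ≤ 1 - 2 / Real.pi ^ 2 * (n * r) ^ 2 :=
      Real.cos_le_one_sub_mul_cos_sq (by
        rw [abs_of_nonneg (by linarith)]; linarith [Real.pi_gt_three])
    have h6 : 2 / Real.pi ^ 2 ≤ 2 / Real.pi ^ 2 * (n * r) ^ 2 :=
      le_mul_of_one_le_right (by positivity) (one_le_pow₀ h3)
    have h7 : (2 * N : ℝ) ^ (-(2 * a) - 1) ≤ (n : ℝ) ^ (-(2 * a) - 1) :=
      Real.rpow_le_rpow_of_nonpos (by linarith) h2' (by linarith)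
    exact mul_le_mul h7 (by linarith) (by positivity) (by positivity)
  have h8 := Finset.sum_le_sum key
  rw [Finset.sum_const, Nat.card_Ico, nsmul_eq_mul] at h8
  refine le_trans ?_ h8
  have h9 : ((2 * N - N : ℕ) : ℝ) = N := by rw [show 2 * N - N = N by omega]
  have h10 : (N : ℝ) * (N : ℝ) ^ (-(2 * a) - 1) = (N : ℝ) ^ (-(2 * a)) := by
    rw [Real.rpow_sub_one hNpos.ne']; field_simp
  have h11 : 2 ^ (-(2 * a)) * r ^ (2 * a) ≤ (N : ℝ) ^ (-(2 * a)) := by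
    calc _ = (2 / r) ^ (-(2 * a)) := by
          rw [Real.div_rpow (by norm_num) hr.le, Real.rpow_neg hr.le, div_inv_eq_mul]
      _ ≤ _ := Real.rpow_le_rpow_of_nonpos hNpos hN2 (by linarith)
  rw [h9, Real.mul_rpow (by norm_num) hNpos.le, lowerConst]
  calc _ = 2 / Real.pi ^ 2 * 2 ^ (-(2 * a) - 1) * (2 ^ (-(2 * a)) * r ^ (2 * a)) := by ring
    _ ≤ 2 / Real.pi ^ 2 * 2 ^ (-(2 * a) - 1) * (N : ℝ) ^ (-(2 * a)) := by gcongr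
    _ = _ := by rw [← h10]; ring

theorem lowerConst_pos (a : ℝ) : 0 < lowerConst a := by
  unfold lowerConst; positivity

theorem upperConst_pos {a : ℝ} (ha : 0 < a) (ha1 : a < 1) : 0 < upperConst a := by
  have : 0 < 2 - 2 * a := by linarith
  unfold upperConst; positivity

/-! ### Variance of the Riemann sums -/

/-- The jumps of a sequence, with `0` as value before the index `0`. -/
def jump (φ : ℕ → ℝ) (k : ℕ) : ℝ := if k = 0 then φ 0 else φ k - φ (k - 1)

theorem sum_jump (φ : ℕ → ℝ) (N : ℕ) : ∑ k ∈ Finset.range (N + 1), jump φ k = φ N := by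
  induction N with
  | zero => simp [jump]
  | succ N ih => rw [Finset.sum_range_succ, ih]; simp [jump]

/-- Abel summation. -/
theorem sum_mul_sub_eq_sum_jump (φ b : ℕ → ℝ) (N : ℕ) :
    ∑ k ∈ Finset.range N, φ k * (b (k + 1) - b k) =
      ∑ k ∈ Finset.range N, jump φ k * (b N - b k) := by
  induction N with
  | zero => simp
  | succ N ih =>
    have h : ∑ k ∈ Finset.range (N + 1), jump φ k * (b (N + 1) - b k) =
        ∑ k ∈ Finset.range (N + 1), jump φ k * (b N - b k) +
          (∑ k ∈ Finset.range (N + 1), jump φ k) * (b (N + 1) - b N) := by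
      rw [Finset.sum_mul, ← Finset.sum_add_distrib]
      exact Finset.sum_congr rfl fun k _ => by ring
    rw [h, sum_jump, Finset.sum_range_succ, ih, Finset.sum_range_succ _ N]
    ring

theorem jump_nonneg {φ : ℕ → ℝ} (h0 : 0 ≤ φ 0) (hφ : Monotone φ) (k : ℕ) : 0 ≤ jump φ k := by
  unfold jump
  split_ifs
  · exact h0
  · exact sub_nonneg.mpr (hφ (Nat.sub_le k 1))

/-- Left-endpoint Riemann sums of `∫ d(y²) / y = 2 ∫ dy`. -/
theorem sum_jump_sq_div_le {y : ℕ → ℝ} (hy : ∀ k, 0 < y k) (hm : Monotone y) (N : ℕ) :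
    ∑ k ∈ Finset.range (N + 1), jump (fun k => y k ^ 2) k / y k ≤ 2 * y N := by
  rw [← sum_jump y N, Finset.mul_sum]
  refine Finset.sum_le_sum fun k _ => ?_
  rw [div_le_iff₀ (hy k)]
  unfold jump
  split_ifs with h
  · subst h; nlinarith [hy 0]
  · have h1 := hm (Nat.sub_le k 1)
    nlinarith [hy k, hy (k - 1)]

section Covariance

variable {H : ℝ}

theorem fbmCov_le (s t : ℝ≥0) : fbmCov H s t ≤ ((t : ℝ) ^ (2 * H) + (s : ℝ) ^ (2 * H)) / 2 := by
  have : 0 ≤ |(t : ℝ) - s| ^ (2 * H) := by positivity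
  unfold fbmCov; linarith

/-- Positive association of fractional Brownian motion: the term `|t - s| ^ (2H)` is at most
`max s t ^ (2H)`, so that `min s t ^ (2H) / 2` is left over. This holds for every `H > 0`. -/
theorem le_fbmCov (hH : 0 < H) {r s t : ℝ≥0} (hs : r ≤ s) (ht : r ≤ t) :
    (r : ℝ) ^ (2 * H) / 2 ≤ fbmCov H s t := by
  have h2 : 0 ≤ 2 * H := by linarith
  have key : ∀ a b : ℝ≥0, r ≤ a → a ≤ b →
      (r : ℝ) ^ (2 * H) + |(b : ℝ) - a| ^ (2 * H) ≤ (a : ℝ) ^ (2 * H) + (b : ℝ) ^ (2 * H) := by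
    intro a b hra hab
    have hra' : (r : ℝ) ≤ a := hra
    have hab' : (a : ℝ) ≤ b := hab
    have h1 : (r : ℝ) ^ (2 * H) ≤ (a : ℝ) ^ (2 * H) := Real.rpow_le_rpow r.2 hra' h2
    have h3 : |(b : ℝ) - a| ^ (2 * H) ≤ (b : ℝ) ^ (2 * H) := by
      refine Real.rpow_le_rpow (abs_nonneg _) ?_ h2
      rw [abs_of_nonneg (by linarith)]
      linarith [a.2]
    linarith
  unfold fbmCov
  rcases le_total s t with h | h
  · linarith [key s t hs h]
  · rw [abs_sub_comm]; linarith [key t s ht h]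

theorem fbmCov_nonneg (hH : 0 < H) (s t : ℝ≥0) : 0 ≤ fbmCov H s t := by
  have := le_fbmCov hH (zero_le (a := s)) (zero_le (a := t))
  rwa [NNReal.coe_zero, Real.zero_rpow (by linarith), zero_div] at this

/-- The increments of fractional Brownian motion back from time `t` have again the covariance
`fbmCov`. -/
theorem fbmCov_sub_sub {r s t : ℝ≥0} (hr : r ≤ t) (hs : s ≤ t) (hH : 0 < H) :
    fbmCov H t t - fbmCov H t s - fbmCov H r t + fbmCov H r s = fbmCov H (t - r) (t - s) := by
  unfold fbmCov
  have hr' : (r : ℝ) ≤ t := hr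
  have hs' : (s : ℝ) ≤ t := hs
  rw [NNReal.coe_sub hr, NNReal.coe_sub hs, abs_sub_comm (s : ℝ) t,
    abs_of_nonneg (sub_nonneg.mpr hr'), abs_of_nonneg (sub_nonneg.mpr hs'), sub_self, abs_zero,
    Real.zero_rpow (by linarith), show (t : ℝ) - s - (t - r) = -(s - r) by ring, abs_neg]
  ring

end Covariance

/-- The `k`-th node `k t / N` of the uniform partition of `[0, t]` into `N` intervals. -/
noncomputable def node (t : ℝ≥0) (N k : ℕ) : ℝ≥0 := k * t / N

theorem node_self (t : ℝ≥0) {N : ℕ} (hN : N ≠ 0) : node t N N = t := by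
  have : (N : ℝ≥0) ≠ 0 := by exact_mod_cast hN
  unfold node; field_simp

theorem node_mono (t : ℝ≥0) (N : ℕ) : Monotone (node t N) := by
  intro a b h
  unfold node
  gcongr

theorem node_le (t : ℝ≥0) {N k : ℕ} (hk : k ≤ N) : node t N k ≤ t := by
  rcases Nat.eq_zero_or_pos N with h | h
  · subst h; simp [node]
  · exact (node_mono t N hk).trans_eq (node_self t h.ne')

theorem node_succ (t : ℝ≥0) (N k : ℕ) : node t N (k + 1) = node t N k + t / N := by
  unfold node; push_cast; ring

/-- The Riemann sum of `∫₀ᵗ e^{-l (t - s)} B(ds)` for the uniform partition of `[0, t]` into `N`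
intervals, tagged at the left endpoints. -/
noncomputable def riemannSum {Ω : Type*} (B : ℝ≥0 → Ω → ℝ) (l : ℝ) (t : ℝ≥0) (N : ℕ) (ω : Ω) : ℝ :=
  ∑ k ∈ Finset.range N, Real.exp (-l * ((t : ℝ) - node t N k)) *
    (B (node t N (k + 1)) ω - B (node t N k) ω)

/-- The variance of `riemannSum B l t N` for a fractional Brownian motion `B`. -/
noncomputable def riemannVar (H l : ℝ) (t : ℝ≥0) (N : ℕ) : ℝ :=
  ∑ k ∈ Finset.range N, ∑ j ∈ Finset.range N,
    jump (fun k => Real.exp (-l * ((t : ℝ) - node t N k))) k *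
    jump (fun k => Real.exp (-l * ((t : ℝ) - node t N k))) j *
    fbmCov H (t - node t N k) (t - node t N j)

theorem monotone_exp_node {l : ℝ} (hl : 0 ≤ l) (t : ℝ≥0) (N : ℕ) :
    Monotone fun k => Real.exp (-l * ((t : ℝ) - node t N k)) := by
  intro a b h
  have h1 : (node t N a : ℝ) ≤ node t N b := node_mono t N h
  refine Real.exp_le_exp.mpr ?_
  nlinarith

theorem jump_exp_nonneg {l : ℝ} (hl : 0 ≤ l) (t : ℝ≥0) (N k : ℕ) :
    0 ≤ jump (fun k => Real.exp (-l * ((t : ℝ) - node t N k))) k :=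
  jump_nonneg (Real.exp_pos _).le (monotone_exp_node hl t N) k

theorem rpow_two_mul_le_exp {H x : ℝ} (hH : 0 < H) (hH1 : H < 1) (hx : 0 ≤ x) :
    x ^ (2 * H) ≤ 8 * Real.exp (x / 2) := by
  have h1 : x ^ (2 * H) ≤ 1 + x ^ 2 := by
    rcases le_total x 1 with h | h
    · have := Real.rpow_le_one hx h (show 0 ≤ 2 * H by linarith)
      nlinarith [sq_nonneg x]
    · have := Real.rpow_le_rpow_of_exponent_le h (show 2 * H ≤ 2 by linarith)
      rw [Real.rpow_two] at this
      linarith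
  have h2 := Real.quadratic_le_exp_of_nonneg (show 0 ≤ x / 2 by linarith)
  nlinarith

/-- The weights add up to at most `1`, and `x ^ (2H) ≤ 8 e^{x / 2}` reduces the bound to a
telescoping sum of values of `e^{-l (t - s) / 2}`. -/
theorem riemannVar_le {H l : ℝ} (hH : 0 < H) (hH1 : H < 1) (hl : 0 < l) (t : ℝ≥0) (N : ℕ) :
    riemannVar H l t N ≤ 16 * l ^ (-(2 * H)) := by
  rcases N with _ | N
  · simp only [riemannVar, Finset.range_zero, Finset.sum_empty]; positivity
  set φ : ℕ → ℝ := fun k => Real.exp (-l * ((t : ℝ) - node t (N + 1) k)) with hφ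
  set y : ℕ → ℝ := fun k => Real.exp (-(l / 2) * ((t : ℝ) - node t (N + 1) k)) with hy
  set a : ℕ → ℝ := fun k => ((t - node t (N + 1) k : ℝ≥0) : ℝ) ^ (2 * H) with ha
  have hφy : φ = fun k => y k ^ 2 := by
    funext k
    simp only [hφ, hy]
    rw [← Real.exp_nat_mul]
    congr 1; push_cast; ring
  have hj : ∀ k, 0 ≤ jump φ k := jump_exp_nonneg hl.le t (N + 1)
  have hy1 : y N ≤ 1 := by
    have h1 : (node t (N + 1) N : ℝ) ≤ t := node_le t (Nat.le_succ N)
    exact Real.exp_le_one_iff.mpr (by nlinarith)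
  have hM : φ N ≤ 1 := by
    rw [hφy]; exact pow_le_one₀ (Real.exp_pos _).le hy1
  have hM0 : 0 ≤ φ N := (Real.exp_pos _).le
  have hak : ∀ k ∈ Finset.range (N + 1), a k ≤ 8 * l ^ (-(2 * H)) / y k := by
    intro k hk
    have hk' : node t (N + 1) k ≤ t := node_le t (Finset.mem_range.mp hk).le
    have hk2 : (node t (N + 1) k : ℝ) ≤ t := hk'
    have h1 := rpow_two_mul_le_exp hH hH1 (x := l * ((t : ℝ) - node t (N + 1) k))
      (mul_nonneg hl.le (by linarith))
    rw [Real.mul_rpow hl.le (by linarith)] at h1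
    have h3 : Real.exp (l * ((t : ℝ) - node t (N + 1) k) / 2) = (y k)⁻¹ := by
      simp only [hy]; rw [← Real.exp_neg]; congr 1; ring
    rw [h3] at h1
    simp only [ha]
    rw [NNReal.coe_sub hk', Real.rpow_neg hl.le]
    have h4 : 0 < l ^ (2 * H) := by positivity
    rw [show 8 * (l ^ (2 * H))⁻¹ / y k = (8 * (y k)⁻¹) / l ^ (2 * H) by
      rw [div_eq_mul_inv, div_eq_mul_inv]; ring, le_div_iff₀ h4]
    linarith
  have hsum : ∑ k ∈ Finset.range (N + 1), jump φ k * a k ≤ 16 * l ^ (-(2 * H)) := by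
    calc _ ≤ ∑ k ∈ Finset.range (N + 1), 8 * l ^ (-(2 * H)) * (jump φ k / y k) := by
          refine Finset.sum_le_sum fun k hk => ?_
          have := mul_le_mul_of_nonneg_left (hak k hk) (hj k)
          refine this.trans_eq ?_
          ring
      _ = 8 * l ^ (-(2 * H)) * ∑ k ∈ Finset.range (N + 1), jump φ k / y k := by
          rw [Finset.mul_sum]
      _ ≤ 8 * l ^ (-(2 * H)) * (2 * y N) := by
          refine mul_le_mul_of_nonneg_left ?_ (by positivity)
          rw [hφy]
          refine sum_jump_sq_div_le (fun k => Real.exp_pos _) ?_ N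
          exact monotone_exp_node (by linarith) t (N + 1)
      _ ≤ _ := by
          have : 0 < l ^ (-(2 * H)) := by positivity
          nlinarith
  have hsum0 : 0 ≤ ∑ k ∈ Finset.range (N + 1), jump φ k * a k :=
    Finset.sum_nonneg fun k _ => mul_nonneg (hj k) (by positivity)
  calc riemannVar H l t (N + 1)
      ≤ ∑ k ∈ Finset.range (N + 1), ∑ j ∈ Finset.range (N + 1),
          (jump φ k * a k * jump φ j / 2 + jump φ k * (jump φ j * a j) / 2) := by
        refine Finset.sum_le_sum fun k _ => Finset.sum_le_sum fun j _ => ?_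
        have := mul_le_mul_of_nonneg_left (fbmCov_le (H := H) (t - node t (N + 1) k)
          (t - node t (N + 1) j)) (mul_nonneg (hj k) (hj j))
        refine this.trans_eq ?_
        ring
    _ = φ N * ∑ k ∈ Finset.range (N + 1), jump φ k * a k := by
        simp_rw [Finset.sum_add_distrib, ← Finset.sum_div, ← Finset.mul_sum, ← Finset.sum_mul,
          sum_jump]
        ring
    _ ≤ 1 * ∑ k ∈ Finset.range (N + 1), jump φ k * a k := by gcongr
    _ ≤ _ := by rw [one_mul]; exact hsum

/-- The weights at distance at least `s` from `t` have total mass at least `e^{-2 l s}`, and any two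
of the corresponding increments have covariance at least `s^{2H} / 2`. -/
theorem le_riemannVar {H l : ℝ} (hH : 0 < H) (hl : 0 ≤ l) {s t : ℝ≥0} (hs : 0 < s)
    (hst : s ≤ t) {N : ℕ} (hN : N ≠ 0) (hNs : t / N ≤ s) :
    (s : ℝ) ^ (2 * H) / 2 * Real.exp (-4 * l * s) ≤ riemannVar H l t N := by
  set φ : ℕ → ℝ := fun k => Real.exp (-l * ((t : ℝ) - node t N k)) with hφ
  have hj : ∀ k, 0 ≤ jump φ k := jump_exp_nonneg hl t N
  have ht : 0 < t := hs.trans_le hst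
  have hN' : (0 : ℝ≥0) < N := by exact_mod_cast Nat.pos_of_ne_zero hN
  -- the last node at distance at least `s` from `t`
  set K := ⌊(t - s) * N / t⌋₊ with hK
  have hK1 : node t N K ≤ t - s := by
    have : (K : ℝ≥0) ≤ (t - s) * N / t := Nat.floor_le zero_le
    unfold node
    rw [div_le_iff₀ hN']
    rwa [le_div_iff₀ ht] at this
  have hK2 : t - s ≤ node t N (K + 1) := by
    have : (t - s) * N / t ≤ (K + 1 : ℕ) := by exact_mod_cast (Nat.lt_floor_add_one _).le
    unfold node
    rw [le_div_iff₀ hN']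
    rwa [div_le_iff₀ ht] at this
  have hKN : K < N := by
    by_contra! h
    have h1 := (node_mono t N h).trans hK1
    rw [node_self t hN] at h1
    have h2 : t - s < t := tsub_lt_self ht hs
    exact absurd h1 (not_le.mpr h2)
  have hφK : Real.exp (-2 * l * s) ≤ φ K := by
    refine Real.exp_le_exp.mpr ?_
    rw [node_succ] at hK2
    have h1 : ((t - s : ℝ≥0) : ℝ) ≤ (node t N K : ℝ) + ((t / N : ℝ≥0) : ℝ) := by exact_mod_cast hK2
    rw [NNReal.coe_sub hst] at h1
    have h2 : ((t / N : ℝ≥0) : ℝ) ≤ s := hNs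
    nlinarith
  have hdist : ∀ k ∈ Finset.range (K + 1), s ≤ t - node t N k := by
    intro k hk
    have h1 : node t N k ≤ t - s :=
      (node_mono t N (Nat.lt_succ_iff.mp (Finset.mem_range.mp hk))).trans hK1
    exact le_tsub_of_add_le_right ((add_le_add_right h1 s).trans_eq (by
      rw [add_tsub_cancel_of_le hst]))
  have hsub : Finset.range (K + 1) ⊆ Finset.range N := Finset.range_subset_range.mpr hKN
  have hnn : ∀ k j, 0 ≤ jump φ k * jump φ j * fbmCov H (t - node t N k) (t - node t N j) :=
    fun k j => mul_nonneg (mul_nonneg (hj k) (hj j)) (fbmCov_nonneg hH _ _)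
  calc (s : ℝ) ^ (2 * H) / 2 * Real.exp (-4 * l * s)
      = (s : ℝ) ^ (2 * H) / 2 * (Real.exp (-2 * l * s) * Real.exp (-2 * l * s)) := by
        rw [← Real.exp_add]; congr 2; ring
    _ ≤ (s : ℝ) ^ (2 * H) / 2 * (φ K * φ K) := by gcongr
    _ = ∑ k ∈ Finset.range (K + 1), ∑ j ∈ Finset.range (K + 1),
          jump φ k * jump φ j * ((s : ℝ) ^ (2 * H) / 2) := by
        simp_rw [← Finset.sum_mul, ← Finset.mul_sum, ← Finset.sum_mul, sum_jump]
        ring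
    _ ≤ ∑ k ∈ Finset.range (K + 1), ∑ j ∈ Finset.range (K + 1),
          jump φ k * jump φ j * fbmCov H (t - node t N k) (t - node t N j) := by
        refine Finset.sum_le_sum fun k hk => Finset.sum_le_sum fun j hj' => ?_
        exact mul_le_mul_of_nonneg_left (le_fbmCov hH (hdist k hk) (hdist j hj'))
          (mul_nonneg (hj k) (hj j))
    _ ≤ ∑ k ∈ Finset.range (K + 1), ∑ j ∈ Finset.range N,
          jump φ k * jump φ j * fbmCov H (t - node t N k) (t - node t N j) :=
        Finset.sum_le_sum fun k _ => Finset.sum_le_sum_of_subset_of_nonneg hsub fun j _ _ => hnn k j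
    _ ≤ _ := Finset.sum_le_sum_of_subset_of_nonneg hsub
        fun k _ _ => Finset.sum_nonneg fun j _ => hnn k j

theorem riemannSum_eq_sum_jump {Ω : Type*} (B : ℝ≥0 → Ω → ℝ) (l : ℝ) (t : ℝ≥0)
    {N : ℕ} (hN : N ≠ 0) (ω : Ω) :
    riemannSum B l t N ω = ∑ k ∈ Finset.range N,
      jump (fun k => Real.exp (-l * ((t : ℝ) - node t N k))) k * (B t ω - B (node t N k) ω) := by
  have := sum_mul_sub_eq_sum_jump (fun k => Real.exp (-l * ((t : ℝ) - node t N k)))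
    (fun k => B (node t N k) ω) N
  rw [node_self t hN] at this
  exact this

section FractionalBrownianMotion

variable {Ω : Type*} [MeasurableSpace Ω] {P : Measure Ω} {H : ℝ} {B : ℝ≥0 → Ω → ℝ}

theorem IsFBM.memLp (hB : IsFBM P H B) (t : ℝ≥0) : MemLp (B t) 2 P :=
  (hB.gaussian.hasGaussianLaw_eval t).memLp_two

theorem IsFBM.integral_sub_mul_sub (hB : IsFBM P H B) (hH : 0 < H) {r s t : ℝ≥0} (hr : r ≤ t)
    (hs : s ≤ t) : ∫ ω, (B t ω - B r ω) * (B t ω - B s ω) ∂P = fbmCov H (t - r) (t - s) := by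
  have hi : ∀ a b, Integrable (fun ω => B a ω * B b ω) P := fun a b =>
    (hB.memLp a).integrable_mul (hB.memLp b)
  have h1 : (fun ω => (B t ω - B r ω) * (B t ω - B s ω)) =
      fun ω => B t ω * B t ω - B t ω * B s ω - B r ω * B t ω + B r ω * B s ω := by
    funext ω; ring
  rw [h1, integral_add, integral_sub, integral_sub, hB.cov, hB.cov, hB.cov, hB.cov]
  · exact fbmCov_sub_sub hr hs hH
  exacts [hi t t, hi t s, (hi t t).sub (hi t s), hi r t, ((hi t t).sub (hi t s)).sub (hi r t),
    hi r s]

theorem IsFBM.integral_riemannSum_sq (hB : IsFBM P H B) (hH : 0 < H) (l : ℝ) (t : ℝ≥0) {N : ℕ}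
    (hN : N ≠ 0) : ∫ ω, riemannSum B l t N ω ^ 2 ∂P = riemannVar H l t N := by
  set m := jump (fun k => Real.exp (-l * ((t : ℝ) - node t N k))) with hm
  have hD : ∀ k, MemLp (fun ω => B t ω - B (node t N k) ω) 2 P := fun k =>
    (hB.memLp t).sub (hB.memLp _)
  have hi : ∀ k j, Integrable (fun ω => m k * m j *
      ((B t ω - B (node t N k) ω) * (B t ω - B (node t N j) ω))) P := fun k j =>
    ((hD k).integrable_mul (hD j)).const_mul _
  have h1 : (fun ω => riemannSum B l t N ω ^ 2) = fun ω => ∑ k ∈ Finset.range N,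
      ∑ j ∈ Finset.range N, m k * m j *
        ((B t ω - B (node t N k) ω) * (B t ω - B (node t N j) ω)) := by
    funext ω
    rw [riemannSum_eq_sum_jump B l t hN, sq, Finset.sum_mul_sum]
    exact Finset.sum_congr rfl fun k _ => Finset.sum_congr rfl fun j _ => by ring
  rw [h1, integral_finsetSum _ fun k _ => integrable_finsetSum _ fun j _ => hi k j]
  refine Finset.sum_congr rfl fun k hk => ?_
  rw [integral_finsetSum _ fun j _ => hi k j]
  refine Finset.sum_congr rfl fun j hj => ?_
  rw [integral_const_mul, hB.integral_sub_mul_sub hH (node_le t (Finset.mem_range.mp hk).le)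
    (node_le t (Finset.mem_range.mp hj).le)]

theorem IsFBM.hasGaussianLaw_riemannSum (hB : IsFBM P H B) (l : ℝ) (t : ℝ≥0) (N : ℕ) :
    HasGaussianLaw (riemannSum B l t N) P := by
  let c : Fin N → ℝ := fun k => Real.exp (-l * ((t : ℝ) - node t N k))
  let L : (Finset.range (N + 1) → ℝ) →L[ℝ] ℝ := ∑ k : Fin N, c k •
    ((ContinuousLinearMap.proj ⟨(k : ℕ) + 1, Finset.mem_range.mpr (by omega)⟩ :
        (Finset.range (N + 1) → ℝ) →L[ℝ] ℝ) -
      ContinuousLinearMap.proj ⟨(k : ℕ), Finset.mem_range.mpr (by omega)⟩)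
  have h := ((hB.gaussian.comp_right (node t N)).hasGaussianLaw (Finset.range (N + 1))).map_fun L
  have e : riemannSum B l t N =
      fun ω => L ((Finset.range (N + 1)).restrict fun k => (B ∘ node t N) k ω) := by
    funext ω
    simp [riemannSum, L, c, Finset.sum_range, Finset.restrict]
  rwa [e]

theorem IsFBM.memLp_riemannSum (hB : IsFBM P H B) (l : ℝ) (t : ℝ≥0) (N : ℕ) :
    MemLp (riemannSum B l t N) 2 P := (hB.hasGaussianLaw_riemannSum l t N).memLp_two

theorem IsFBM.integral_riemannSum (hB : IsFBM P H B) (l : ℝ) (t : ℝ≥0) (N : ℕ) :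
    ∫ ω, riemannSum B l t N ω ∂P = 0 := by
  have := (hB.gaussian.isProbabilityMeasure)
  have hi : ∀ s, Integrable (B s) P := fun s => (hB.memLp s).integrable one_le_two
  unfold riemannSum
  rw [integral_finsetSum]
  · refine Finset.sum_eq_zero fun k _ => ?_
    rw [integral_const_mul, integral_sub (hi _) (hi _), hB.mean_zero, hB.mean_zero]
    ring
  · exact fun k _ => ((hi _).sub (hi _)).const_mul _

end FractionalBrownianMotion

/-! ### Limits in `L²` and sub-Gaussian variables -/

section SquareIntegrable

variable {Ω : Type*} [MeasurableSpace Ω] {P : Measure Ω}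

theorem tendsto_integral_mul_of_tendsto_eLpNorm {X Y : ℕ → Ω → ℝ} {X' Y' : Ω → ℝ}
    (hX : ∀ n, MemLp (X n) 2 P) (hY : ∀ n, MemLp (Y n) 2 P) (hX' : MemLp X' 2 P)
    (hY' : MemLp Y' 2 P)
    (h1 : Tendsto (fun n => eLpNorm (fun ω => X n ω - X' ω) 2 P) atTop (𝓝 0))
    (h2 : Tendsto (fun n => eLpNorm (fun ω => Y n ω - Y' ω) 2 P) atTop (𝓝 0)) :
    Tendsto (fun n => ∫ ω, X n ω * Y n ω ∂P) atTop (𝓝 (∫ ω, X' ω * Y' ω ∂P)) := by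
  have key : ∀ {F G : Ω → ℝ} (hF : MemLp F 2 P) (hG : MemLp G 2 P),
      inner ℝ (hG.toLp G) (hF.toLp F) = ∫ ω, F ω * G ω ∂P := by
    intro F G hF hG
    rw [L2.inner_def]
    refine integral_congr_ae ?_
    filter_upwards [hF.coeFn_toLp, hG.coeFn_toLp] with ω h3 h4
    simp [h3, h4]
  have h3 := (Lp.tendsto_Lp_iff_tendsto_eLpNorm'' X hX X' hX').mpr h1
  have h4 := (Lp.tendsto_Lp_iff_tendsto_eLpNorm'' Y hY Y' hY').mpr h2
  have := h4.inner (𝕜 := ℝ) h3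
  simpa only [key] using this

theorem tendsto_eLpNorm_finset_sum_mul {ι : Type*} (s : Finset ι) (κ : ι → ℝ)
    {X : ι → ℕ → Ω → ℝ} {Y : ι → Ω → ℝ} (hX : ∀ a n, MemLp (X a n) 2 P)
    (hY : ∀ a, MemLp (Y a) 2 P)
    (h : ∀ a, Tendsto (fun n => eLpNorm (fun ω => X a n ω - Y a ω) 2 P) atTop (𝓝 0)) :
    Tendsto (fun n => eLpNorm (fun ω => ∑ a ∈ s, κ a * X a n ω - ∑ a ∈ s, κ a * Y a ω) 2 P)
      atTop (𝓝 0) := by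
  have hlim : Tendsto (fun n => ∑ a ∈ s, ‖κ a‖ₑ * eLpNorm (fun ω => X a n ω - Y a ω) 2 P)
      atTop (𝓝 0) := by
    have := tendsto_finsetSum s fun a _ =>
      ENNReal.Tendsto.const_mul (h a) (Or.inr (enorm_ne_top (x := κ a)))
    simpa using this
  refine tendsto_of_tendsto_of_tendsto_of_le_of_le tendsto_const_nhds hlim (fun _ => zero_le)
    fun n => ?_
  have e : (fun ω => ∑ a ∈ s, κ a * X a n ω - ∑ a ∈ s, κ a * Y a ω) =
      ∑ a ∈ s, fun ω => κ a * (X a n ω - Y a ω) := by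
    funext ω
    rw [← Finset.sum_sub_distrib, Finset.sum_apply]
    exact Finset.sum_congr rfl fun a _ => by ring
  dsimp only
  rw [e]
  refine (eLpNorm_sum_le (fun a _ => (((hX a n).sub (hY a)).const_mul _).1) one_le_two).trans ?_
  refine Finset.sum_le_sum fun a _ => ?_
  exact (eLpNorm_const_smul (κ a) (fun ω => X a n ω - Y a ω) 2 P).le

/-- An `L²` limit of sub-Gaussian variables is sub-Gaussian, by Fatou's lemma. -/
theorem hasSubgaussianMGF_of_tendsto_eLpNorm {X : ℕ → Ω → ℝ} {Y : Ω → ℝ} {c : ℕ → ℝ≥0} {c' : ℝ≥0}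
    (hX : ∀ᶠ n in atTop, HasSubgaussianMGF (X n) (c n) P) (hX2 : ∀ n, MemLp (X n) 2 P)
    (hY : MemLp Y 2 P)
    (h : Tendsto (fun n => eLpNorm (fun ω => X n ω - Y ω) 2 P) atTop (𝓝 0))
    (hc : Tendsto c atTop (𝓝 c')) : HasSubgaussianMGF Y c' P := by
  obtain ⟨ns, hns, hae⟩ := (tendstoInMeasure_of_tendsto_eLpNorm two_ne_zero
    (fun n => (hX2 n).1) hY.1 h).exists_seq_tendsto_ae
  have hbound : ∀ θ : ℝ, ∫⁻ ω, ENNReal.ofReal (Real.exp (θ * Y ω)) ∂P ≤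
      ENNReal.ofReal (Real.exp (c' * θ ^ 2 / 2)) := by
    intro θ
    have hcont : Continuous fun x : ℝ => ENNReal.ofReal (Real.exp (θ * x)) :=
      ENNReal.continuous_ofReal.comp (by fun_prop)
    have h1 : ∫⁻ ω, ENNReal.ofReal (Real.exp (θ * Y ω)) ∂P =
        ∫⁻ ω, liminf (fun n => ENNReal.ofReal (Real.exp (θ * X (ns n) ω))) atTop ∂P := by
      refine lintegral_congr_ae ?_
      filter_upwards [hae] with ω hω
      exact ((hcont.tendsto _).comp hω).liminf_eq.symm
    rw [h1]
    refine (lintegral_liminf_le' fun n => ?_).trans ?_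
    · exact hcont.measurable.comp_aemeasurable (hX2 (ns n)).1.aemeasurable
    have h2 : Tendsto (fun n => ENNReal.ofReal (Real.exp (c (ns n) * θ ^ 2 / 2))) atTop
        (𝓝 (ENNReal.ofReal (Real.exp (c' * θ ^ 2 / 2)))) := by
      have hcont2 : Continuous fun x : ℝ≥0 => ENNReal.ofReal (Real.exp (x * θ ^ 2 / 2)) :=
        ENNReal.continuous_ofReal.comp (by fun_prop)
      exact (hcont2.tendsto _).comp (hc.comp hns.tendsto_atTop)
    rw [← h2.liminf_eq]
    refine liminf_le_liminf ?_
    filter_upwards [hns.tendsto_atTop.eventually hX] with n hn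
    rw [← ofReal_integral_eq_lintegral_ofReal (hn.integrable_exp_mul θ)
      (ae_of_all _ fun ω => (Real.exp_pos _).le)]
    exact ENNReal.ofReal_le_ofReal (hn.mgf_le θ)
  have hm : ∀ θ : ℝ, AEStronglyMeasurable (fun ω => Real.exp (θ * Y ω)) P := fun θ =>
    (by fun_prop : Continuous fun x : ℝ => Real.exp (θ * x)).comp_aestronglyMeasurable hY.1
  have hint : ∀ θ : ℝ, Integrable (fun ω => Real.exp (θ * Y ω)) P := fun θ => by
    refine ⟨hm θ, ?_⟩
    rw [hasFiniteIntegral_iff_ofReal (ae_of_all _ fun ω => (Real.exp_pos _).le)]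
    exact (hbound θ).trans_lt ENNReal.ofReal_lt_top
  refine ⟨hint, fun θ => ?_⟩
  have := hbound θ
  rw [← ofReal_integral_eq_lintegral_ofReal (hint θ) (ae_of_all _ fun ω => (Real.exp_pos _).le)]
    at this
  exact (ENNReal.ofReal_le_ofReal_iff (Real.exp_pos _).le).mp this

theorem ProbabilityTheory.HasGaussianLaw.hasSubgaussianMGF {X : Ω → ℝ} (hX : HasGaussianLaw X P)
    (h0 : ∫ ω, X ω ∂P = 0) : HasSubgaussianMGF X (∫ ω, X ω ^ 2 ∂P).toNNReal P := by
  have := hX.isProbabilityMeasure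
  have hmap := hX.map_eq_gaussianReal
  rw [h0, variance_of_integral_eq_zero hX.aemeasurable h0] at hmap
  rw [← HasSubgaussianMGF.id_map_iff hX.aemeasurable, hmap]
  refine ⟨fun t => integrable_exp_mul_gaussianReal t, fun t => ?_⟩
  rw [mgf_id_gaussianReal]
  simp

theorem ProbabilityTheory.HasSubgaussianMGF.mono {X : Ω → ℝ} {c c' : ℝ≥0}
    (h : HasSubgaussianMGF X c P) (hc : c ≤ c') : HasSubgaussianMGF X c' P := by
  refine ⟨h.integrable_exp_mul, fun t => (h.mgf_le t).trans ?_⟩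
  gcongr

end SquareIntegrable

/-! ### The Wiener integrals of the modes -/

section Modes

variable {Ω : Type*} [MeasurableSpace Ω] {P : Measure Ω} {H : ℝ}

theorem IsWienerIntegral.tendsto_riemannSum {B : ℝ≥0 → Ω → ℝ} {l : ℝ} {t : ℝ≥0} {X : Ω → ℝ}
    (hX : IsWienerIntegral P B (fun s : ℝ≥0 => Real.exp (-l * ((t : ℝ) - (s : ℝ)))) t X) :
    Tendsto (fun N => eLpNorm (fun ω => riemannSum B l t N ω - X ω) 2 P) atTop (𝓝 0) := by
  rw [ENNReal.tendsto_atTop_zero]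
  intro ε hε
  obtain ⟨ε', hε', hεε'⟩ : ∃ ε' : ℝ, 0 < ε' ∧ ENNReal.ofReal ε' ≤ ε := by
    rcases eq_or_ne ε ⊤ with h | h
    · exact ⟨1, one_pos, h ▸ le_top⟩
    · exact ⟨ε.toReal, ENNReal.toReal_pos hε.ne' h, (ENNReal.ofReal_toReal h).le⟩
  obtain ⟨η, hη, hsum⟩ := hX.2 ε' hε'
  obtain ⟨N₀, hN₀⟩ := exists_nat_ge (t / η)
  refine ⟨N₀ + 1, fun N hN => ?_⟩
  have hN0 : (N : ℝ≥0) ≠ 0 := by exact_mod_cast (by omega : N ≠ 0)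
  have hmesh : t / N ≤ η := by
    rw [div_le_iff₀ (pos_of_ne_zero hN0), mul_comm]
    rw [div_le_iff₀ hη] at hN₀
    refine hN₀.trans ?_
    gcongr
    omega
  refine le_trans ?_ ((hsum N (node t N) (node t N) (by simp [node]) (node_self t (by omega))
    fun k _ => ⟨le_rfl, node_mono t N (Nat.le_succ k), ?_⟩).trans hεε')
  · exact (eLpNorm_sub_comm (riemannSum B l t N) X 2 P).le
  · rw [node_succ]; gcongr

variable {d : ℕ} {W : Fin d → ℕ → Fin 2 → ℝ≥0 → Ω → ℝ}

/-- The Riemann sum approximating the Wiener integral of the mode `a`. -/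
noncomputable def modeSum (W : Fin d → ℕ → Fin 2 → ℝ≥0 → Ω → ℝ) (t : ℝ≥0)
    (a : Fin d × ℕ × Fin 2) (N : ℕ) : Ω → ℝ :=
  riemannSum (W a.1 a.2.1 a.2.2) ((a.2.1 : ℝ) ^ 2) t N

theorem IsFBMFamily.iIndepFun_modeSum (hW : IsFBMFamily P H W) (t : ℝ≥0) (N : ℕ) :
    iIndepFun (fun a => modeSum W t a N) P := by
  refine hW.indep.comp (fun a (x : ℝ≥0 → ℝ) => riemannSum (fun s (x : ℝ≥0 → ℝ) => x s)
    ((a.2.1 : ℝ) ^ 2) t N x) fun a => ?_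
  unfold riemannSum
  fun_prop

theorem IsFBMFamily.memLp_modeSum (hW : IsFBMFamily P H W) (t : ℝ≥0) (a : Fin d × ℕ × Fin 2)
    (N : ℕ) : MemLp (modeSum W t a N) 2 P := (hW.fbm _ _ _).memLp_riemannSum _ _ _

theorem IsFBMFamily.integral_modeSum_mul (hW : IsFBMFamily P H W) (t : ℝ≥0)
    {a b : Fin d × ℕ × Fin 2} (hab : a ≠ b) (N : ℕ) :
    ∫ ω, modeSum W t a N ω * modeSum W t b N ω ∂P = 0 := by
  have := ((hW.iIndepFun_modeSum t N).indepFun hab).integral_mul_eq_mul_integral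
    (hW.memLp_modeSum t a N).1 (hW.memLp_modeSum t b N).1
  simp only [Pi.mul_apply] at this
  rw [this, modeSum, (hW.fbm _ _ _).integral_riemannSum, zero_mul]

/-- `J a` is, for every mode `a`, the limit in `L²` of the Riemann sums `modeSum W t a N`. -/
structure IsModeFamily (P : Measure Ω) (W : Fin d → ℕ → Fin 2 → ℝ≥0 → Ω → ℝ) (t : ℝ≥0)
    (J : Fin d × ℕ × Fin 2 → Ω → ℝ) : Prop where
  memLp : ∀ a, MemLp (J a) 2 P
  tendsto : ∀ a, Tendsto (fun N => eLpNorm (fun ω => modeSum W t a N ω - J a ω) 2 P) atTop (𝓝 0)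

variable {t : ℝ≥0} {J : Fin d × ℕ × Fin 2 → Ω → ℝ}

theorem IsModeFamily.tendsto_riemannVar (hJ : IsModeFamily P W t J) (hW : IsFBMFamily P H W)
    (hH : 0 < H) (a : Fin d × ℕ × Fin 2) :
    Tendsto (riemannVar H ((a.2.1 : ℝ) ^ 2) t) atTop (𝓝 (∫ ω, J a ω ^ 2 ∂P)) := by
  have := tendsto_integral_mul_of_tendsto_eLpNorm (hW.memLp_modeSum t a) (hW.memLp_modeSum t a)
    (hJ.memLp a) (hJ.memLp a) (hJ.tendsto a) (hJ.tendsto a)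
  simp only [← sq] at this
  refine this.congr' ?_
  filter_upwards [eventually_ne_atTop 0] with N hN
  exact (hW.fbm _ _ _).integral_riemannSum_sq hH _ t hN

theorem IsModeFamily.integral_mul_eq_zero (hJ : IsModeFamily P W t J) (hW : IsFBMFamily P H W)
    {a b : Fin d × ℕ × Fin 2} (hab : a ≠ b) : ∫ ω, J a ω * J b ω ∂P = 0 := by
  have := tendsto_integral_mul_of_tendsto_eLpNorm (hW.memLp_modeSum t a) (hW.memLp_modeSum t b)
    (hJ.memLp a) (hJ.memLp b) (hJ.tendsto a) (hJ.tendsto b)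
  simp only [hW.integral_modeSum_mul t hab] at this
  exact tendsto_nhds_unique this tendsto_const_nhds

theorem IsModeFamily.integral_sum_sq (hJ : IsModeFamily P W t J) (hW : IsFBMFamily P H W)
    (s : Finset (Fin d × ℕ × Fin 2)) (κ : Fin d × ℕ × Fin 2 → ℝ) :
    ∫ ω, (∑ a ∈ s, κ a * J a ω) ^ 2 ∂P = ∑ a ∈ s, κ a ^ 2 * ∫ ω, J a ω ^ 2 ∂P := by
  classical
  have h1 : (fun ω => (∑ a ∈ s, κ a * J a ω) ^ 2) =
      fun ω => ∑ a ∈ s, ∑ b ∈ s, κ a * κ b * (J a ω * J b ω) := by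
    funext ω
    rw [sq, Finset.sum_mul_sum]
    exact Finset.sum_congr rfl fun _ _ => Finset.sum_congr rfl fun _ _ => by ring
  have hi : ∀ a b, Integrable (fun ω => κ a * κ b * (J a ω * J b ω)) P := fun a b =>
    ((hJ.memLp a).integrable_mul (hJ.memLp b)).const_mul _
  rw [h1, integral_finsetSum _ fun a _ => integrable_finsetSum _ fun b _ => hi a b]
  refine Finset.sum_congr rfl fun a ha => ?_
  rw [integral_finsetSum _ fun b _ => hi a b, Finset.sum_eq_single_of_mem a ha]
  · rw [integral_const_mul, sq]
    simp only [sq]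
  · intro b _ hba
    rw [integral_const_mul, hJ.integral_mul_eq_zero hW hba.symm, mul_zero]

theorem IsModeFamily.hasSubgaussianMGF_sum (hJ : IsModeFamily P W t J) (hW : IsFBMFamily P H W)
    (hH : 0 < H) (s : Finset (Fin d × ℕ × Fin 2)) (κ : Fin d × ℕ × Fin 2 → ℝ) :
    HasSubgaussianMGF (fun ω => ∑ a ∈ s, κ a * J a ω)
      (∑ a ∈ s, (κ a ^ 2 * ∫ ω, J a ω ^ 2 ∂P).toNNReal) P := by
  refine hasSubgaussianMGF_of_tendsto_eLpNorm
    (X := fun N ω => ∑ a ∈ s, κ a * modeSum W t a N ω)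
    (c := fun N => ∑ a ∈ s, (κ a ^ 2 * riemannVar H ((a.2.1 : ℝ) ^ 2) t N).toNNReal) ?_
    (fun N => memLp_finsetSum _ fun a _ => (hW.memLp_modeSum t a N).const_mul _)
    (memLp_finsetSum _ fun a _ => (hJ.memLp a).const_mul _)
    (tendsto_eLpNorm_finset_sum_mul s κ (hW.memLp_modeSum t) hJ.memLp hJ.tendsto) ?_
  · filter_upwards [eventually_ne_atTop 0] with N hN
    refine HasSubgaussianMGF.sum_of_iIndepFun
      ((hW.iIndepFun_modeSum t N).comp (fun a x => κ a * x) fun a => by fun_prop) fun a _ => ?_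
    have hG : HasGaussianLaw (fun ω => κ a * modeSum W t a N ω) P :=
      ((hW.fbm a.1 a.2.1 a.2.2).hasGaussianLaw_riemannSum ((a.2.1 : ℝ) ^ 2) t N).fun_smul (κ a)
    have h0 : ∫ ω, κ a * modeSum W t a N ω ∂P = 0 := by
      rw [integral_const_mul, modeSum, (hW.fbm _ _ _).integral_riemannSum, mul_zero]
    have := hG.hasSubgaussianMGF h0
    simp only [mul_pow] at this
    rw [integral_const_mul, modeSum, (hW.fbm _ _ _).integral_riemannSum_sq hH _ t hN] at this
    exact this
  · refine tendsto_finsetSum _ fun a _ => ?_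
    exact (continuous_real_toNNReal.tendsto _).comp
      ((hJ.tendsto_riemannVar hW hH a).const_mul _)

/-- The variances depend on the mode only through its frequency. -/
theorem IsModeFamily.integral_sq_eq (hJ : IsModeFamily P W t J) (hW : IsFBMFamily P H W)
    (hH : 0 < H) (i i' : Fin d) (n : ℕ) (j j' : Fin 2) :
    ∫ ω, J (i, n, j) ω ^ 2 ∂P = ∫ ω, J (i', n, j') ω ^ 2 ∂P :=
  tendsto_nhds_unique (hJ.tendsto_riemannVar hW hH (i, n, j))
    (hJ.tendsto_riemannVar hW hH (i', n, j'))

theorem IsModeFamily.integral_sq_le (hJ : IsModeFamily P W t J) (hW : IsFBMFamily P H W)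
    (hH : 0 < H) (hH1 : H < 1) {a : Fin d × ℕ × Fin 2} (hn : a.2.1 ≠ 0) :
    ∫ ω, J a ω ^ 2 ∂P ≤ 16 * (a.2.1 : ℝ) ^ (-(4 * H)) := by
  have hn' : (0 : ℝ) < a.2.1 := by exact_mod_cast Nat.pos_of_ne_zero hn
  have h : ((a.2.1 : ℝ) ^ 2) ^ (-(2 * H)) = (a.2.1 : ℝ) ^ (-(4 * H)) := by
    rw [← Real.rpow_natCast, ← Real.rpow_mul hn'.le]; congr 1; push_cast; ring
  rw [← h]
  exact le_of_tendsto' (hJ.tendsto_riemannVar hW hH a) fun N =>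
    riemannVar_le hH hH1 (by positivity) t N

theorem IsModeFamily.le_integral_sq (hJ : IsModeFamily P W t J) (hW : IsFBMFamily P H W)
    (hH : 0 < H) {t₀ : ℝ} (ht₀ : 0 < t₀) (ht : t₀ ≤ t) {a : Fin d × ℕ × Fin 2} (hn : a.2.1 ≠ 0) :
    t₀ ^ (2 * H) / 2 * Real.exp (-4 * t₀) * (a.2.1 : ℝ) ^ (-(4 * H)) ≤ ∫ ω, J a ω ^ 2 ∂P := by
  have hn' : (1 : ℝ) ≤ a.2.1 := by exact_mod_cast Nat.pos_of_ne_zero hn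
  have hn0 : (0 : ℝ) < a.2.1 := by linarith
  -- the time scale of the mode; it is at most `t` because the frequency is at least `1`
  set s : ℝ≥0 := ⟨t₀ / (a.2.1 : ℝ) ^ 2, by positivity⟩ with hs
  have hsv : (s : ℝ) = t₀ / (a.2.1 : ℝ) ^ 2 := rfl
  have hs0 : 0 < s := by rw [← NNReal.coe_pos, hsv]; positivity
  have hst : s ≤ t := by
    rw [← NNReal.coe_le_coe, hsv]
    exact (div_le_self ht₀.le (one_le_pow₀ hn')).trans ht
  have e1 : (s : ℝ) ^ (2 * H) = t₀ ^ (2 * H) * (a.2.1 : ℝ) ^ (-(4 * H)) := by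
    rw [hsv, Real.div_rpow ht₀.le (by positivity), ← Real.rpow_natCast, ← Real.rpow_mul hn0.le,
      div_eq_mul_inv, ← Real.rpow_neg hn0.le]
    congr 2; push_cast; ring
  have e2 : -4 * (a.2.1 : ℝ) ^ 2 * s = -4 * t₀ := by rw [hsv]; field_simp
  obtain ⟨N₀, hN₀⟩ := exists_nat_ge (t / s)
  refine ge_of_tendsto (hJ.tendsto_riemannVar hW hH a) ?_
  filter_upwards [eventually_ge_atTop (N₀ + 1)] with N hN
  have hN0 : (N : ℝ≥0) ≠ 0 := by exact_mod_cast (by omega : N ≠ 0)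
  have := le_riemannVar (l := (a.2.1 : ℝ) ^ 2) hH (by positivity) hs0 hst (N := N) (by omega) (by
    rw [div_le_iff₀ (pos_of_ne_zero hN0), mul_comm]
    rw [div_le_iff₀ hs0] at hN₀
    refine hN₀.trans ?_
    gcongr
    omega)
  rw [e1, e2] at this
  refine le_trans (le_of_eq ?_) this
  ring

end Modes

/-! ### Angles -/

section Angle

theorem Real.Angle.norm_eq_abs_toReal (z : Real.Angle) : ‖z‖ = |z.toReal| := by
  have h := (AddCircle.norm_coe_eq_abs_iff (p := 2 * Real.pi) (x := z.toReal)
    (by positivity)).mpr (by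
      rw [abs_of_pos Real.two_pi_pos]
      have := Real.Angle.abs_toReal_le_pi z
      linarith)
  have e : ((z.toReal : Real.Angle)) = z := Real.Angle.coe_toReal z
  calc ‖z‖ = ‖(z.toReal : Real.Angle)‖ := by rw [e]
    _ = _ := h

theorem Real.Angle.norm_coe_le (r : ℝ) : ‖(r : Real.Angle)‖ ≤ |r| := by
  have := QuotientAddGroup.norm_mk_le_norm (S := AddSubgroup.zmultiples (2 * Real.pi)) (m := r)
  exact this

theorem Real.Angle.cos_nsmul (n : ℕ) (z : Real.Angle) :
    Real.Angle.cos (n • z) = Real.cos (n * z.toReal) := by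
  conv_lhs => rw [← Real.Angle.coe_toReal z, ← Real.Angle.coe_nsmul, Real.Angle.cos_coe]
  rw [nsmul_eq_mul]

theorem Real.Angle.cos_nsmul_eq_cos_norm (n : ℕ) (z : Real.Angle) :
    Real.Angle.cos (n • z) = Real.cos (n * ‖z‖) := by
  rw [Real.Angle.cos_nsmul, Real.Angle.norm_eq_abs_toReal, ← Real.cos_abs, abs_mul, Nat.abs_cast]

theorem Real.Angle.sq_cos_sub_add_sq_sin_sub (x y : Real.Angle) :
    (Real.Angle.cos x - Real.Angle.cos y) ^ 2 + (Real.Angle.sin x - Real.Angle.sin y) ^ 2 =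
      2 * (1 - Real.Angle.cos (x - y)) := by
  rw [sub_eq_add_neg x y, Real.Angle.cos_add, Real.Angle.cos_neg, Real.Angle.sin_neg]
  linear_combination Real.Angle.cos_sq_add_sin_sq x + Real.Angle.cos_sq_add_sin_sq y

end Angle

/-! ### Trigonometric series with weights of power order -/

section Series

variable {w : ℕ → ℝ} {a B : ℝ}

theorem summable_of_eventually_le (hw : ∀ n, 0 ≤ w n) (ha : 0 < a)
    (hB : ∀ᶠ n : ℕ in atTop, w n ≤ B * (n : ℝ) ^ (-(2 * a) - 1)) : Summable w := by
  refine Summable.of_norm_bounded_eventually_nat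
    ((Real.summable_nat_rpow.mpr (by linarith : -(2 * a) - 1 < -1)).mul_left B) ?_
  filter_upwards [hB] with n hn
  rwa [Real.norm_of_nonneg (hw n)]

theorem summable_mul_one_sub_cos (hw : ∀ n, 0 ≤ w n) (hs : Summable w) (r : ℝ) :
    Summable fun n : ℕ => w n * (1 - Real.cos (n * r)) := by
  refine Summable.of_nonneg_of_le (fun n => mul_nonneg (hw n) ?_) (fun n => ?_) (hs.mul_right 2)
  · linarith [Real.cos_le_one (n * r)]
  · exact mul_le_mul_of_nonneg_left (by linarith [Real.neg_one_le_cos (n * r)]) (hw n)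

theorem eventually_le_tsum_mul_one_sub_cos (hw : ∀ n, 0 ≤ w n) (hs : Summable w) (ha : 0 < a)
    {A : ℝ} (hA0 : 0 ≤ A) (hA : ∀ᶠ n : ℕ in atTop, A * (n : ℝ) ^ (-(2 * a) - 1) ≤ w n) :
    ∀ᶠ r : ℝ in 𝓝[>] 0, A * lowerConst a * r ^ (2 * a) ≤
      ∑' n : ℕ, w n * (1 - Real.cos (n * r)) := by
  obtain ⟨n₀, hn₀⟩ := eventually_atTop.mp hA
  have hδ : (0 : ℝ) < min (1 / 2) (1 / ((n₀ : ℝ) + 1)) := by positivity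
  filter_upwards [Ioo_mem_nhdsGT hδ] with r hr
  have hr0 : 0 < r := hr.1
  have hr1 : r ≤ 1 / 2 := hr.2.le.trans (min_le_left _ _)
  have hr2 : r ≤ 1 / (n₀ + 1) := hr.2.le.trans (min_le_right _ _)
  have hN : n₀ ≤ ⌈1 / r⌉₊ := by
    have h1 : (n₀ : ℝ) + 1 ≤ 1 / r := by
      rw [le_div_iff₀ hr0]; rw [le_div_iff₀ (by positivity)] at hr2; linarith
    have h2 : (n₀ : ℝ) ≤ ⌈1 / r⌉₊ := by linarith [Nat.le_ceil (1 / r)]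
    exact_mod_cast h2
  calc A * lowerConst a * r ^ (2 * a) = A * (lowerConst a * r ^ (2 * a)) := by ring
    _ ≤ A * ∑ n ∈ Finset.Ico ⌈1 / r⌉₊ (2 * ⌈1 / r⌉₊),
        (n : ℝ) ^ (-(2 * a) - 1) * (1 - Real.cos (n * r)) := by
        gcongr; exact lowerConst_mul_rpow_le_sum ha hr0 hr1
    _ ≤ ∑ n ∈ Finset.Ico ⌈1 / r⌉₊ (2 * ⌈1 / r⌉₊), w n * (1 - Real.cos (n * r)) := by
        rw [Finset.mul_sum]
        refine Finset.sum_le_sum fun n hn => ?_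
        rw [← mul_assoc]
        exact mul_le_mul_of_nonneg_right (hn₀ n (hN.trans (Finset.mem_Ico.mp hn).1))
          (by linarith [Real.cos_le_one (n * r)])
    _ ≤ _ := (summable_mul_one_sub_cos hw hs r).sum_le_tsum _ fun n _ =>
        mul_nonneg (hw n) (by linarith [Real.cos_le_one (n * r)])

/-- Finitely many terms contribute `O(r²)`, which is negligible against `r^(2a)` for `a < 1`. -/
theorem eventually_tsum_mul_one_sub_cos_le (hw : ∀ n, 0 ≤ w n) (ha : 0 < a) (ha1 : a < 1)
    (hB0 : 0 < B) (hB : ∀ᶠ n : ℕ in atTop, w n ≤ B * (n : ℝ) ^ (-(2 * a) - 1)) :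
    ∀ᶠ r : ℝ in 𝓝[>] 0, ∑' n : ℕ, w n * (1 - Real.cos (n * r)) ≤
      2 * upperConst a * B * r ^ (2 * a) := by
  obtain ⟨n₁, hn₁⟩ := eventually_atTop.mp hB
  set n₀ := max n₁ 1 with hn₀
  set M := ∑ n ∈ Finset.range n₀, w n * ((n : ℝ) ^ 2 / 2) with hM
  have hU := upperConst_pos ha ha1
  have hlim : Tendsto (fun r : ℝ => M * r ^ (2 - 2 * a)) (𝓝[>] 0) (𝓝 0) := by
    have h1 : Tendsto (fun r : ℝ => r ^ (2 - 2 * a)) (𝓝[>] 0) (𝓝 (0 ^ (2 - 2 * a))) :=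
      ((Real.continuousAt_rpow_const 0 _ (Or.inr (by linarith))).tendsto).mono_left
        nhdsWithin_le_nhds
    rw [Real.zero_rpow (by linarith)] at h1
    simpa using h1.const_mul M
  filter_upwards [Ioo_mem_nhdsGT one_pos, hlim.eventually_le_const (mul_pos hU hB0)] with r hr hMr
  have hr0 : 0 < r := hr.1
  have hs := summable_of_eventually_le hw ha hB
  have hnn : ∀ n : ℕ, 0 ≤ w n * (1 - Real.cos (n * r)) := fun n =>
    mul_nonneg (hw n) (by linarith [Real.cos_le_one (n * r)])
  have hfin : ∑ n ∈ Finset.range n₀, w n * (1 - Real.cos (n * r)) ≤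
      upperConst a * B * r ^ (2 * a) := by
    calc _ ≤ ∑ n ∈ Finset.range n₀, w n * ((n * r) ^ 2 / 2) :=
          Finset.sum_le_sum fun n _ =>
            mul_le_mul_of_nonneg_left (one_sub_cos_le_sq_div_two _) (hw n)
      _ = M * r ^ (2 - 2 * a) * r ^ (2 * a) := by
          rw [mul_assoc, ← Real.rpow_add hr0, sub_add_cancel, Real.rpow_two, hM, Finset.sum_mul]
          exact Finset.sum_congr rfl fun n _ => by ring
      _ ≤ _ := by gcongr
  refine (summable_mul_one_sub_cos hw hs r).tsum_le_of_sum_range_le fun N => ?_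
  calc ∑ n ∈ Finset.range N, w n * (1 - Real.cos (n * r))
      ≤ ∑ n ∈ Finset.range (n₀ + N), w n * (1 - Real.cos (n * r)) :=
        Finset.sum_le_sum_of_subset_of_nonneg (Finset.range_subset_range.mpr (by omega))
          fun n _ _ => hnn n
    _ = ∑ n ∈ Finset.range n₀, w n * (1 - Real.cos (n * r)) +
        ∑ n ∈ Finset.Ico n₀ (n₀ + N), w n * (1 - Real.cos (n * r)) :=
        (Finset.sum_range_add_sum_Ico _ (by omega)).symm
    _ ≤ upperConst a * B * r ^ (2 * a) + B * (upperConst a * r ^ (2 * a)) := by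
        refine add_le_add hfin ?_
        calc _ ≤ ∑ n ∈ Finset.Ico n₀ (n₀ + N),
                B * ((n : ℝ) ^ (-(2 * a) - 1) * (1 - Real.cos (n * r))) := by
              refine Finset.sum_le_sum fun n hn => ?_
              rw [← mul_assoc]
              exact mul_le_mul_of_nonneg_right
                (hn₁ n ((le_max_left _ _).trans (Finset.mem_Ico.mp hn).1))
                (by linarith [Real.cos_le_one (n * r)])
          _ ≤ ∑ n ∈ Finset.Ico 1 (n₀ + N),
                B * ((n : ℝ) ^ (-(2 * a) - 1) * (1 - Real.cos (n * r))) :=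
              Finset.sum_le_sum_of_subset_of_nonneg
                (Finset.Ico_subset_Ico_left (le_max_right _ _)) fun n _ _ =>
                mul_nonneg hB0.le (mul_nonneg (by positivity)
                  (by linarith [Real.cos_le_one (n * r)]))
          _ ≤ _ := by
              rw [← Finset.mul_sum]
              exact mul_le_mul_of_nonneg_left
                (sum_rpow_mul_one_sub_cos_le ha ha1 hr0 hr.2.le _) hB0.le
    _ = _ := by ring

/-- Away from `r = 0` the upper bound holds trivially, with a worse constant. -/
theorem exists_tsum_mul_one_sub_cos_le (hw : ∀ n, 0 ≤ w n) (ha : 0 < a) (ha1 : a < 1)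
    (hB0 : 0 < B) (hB : ∀ᶠ n : ℕ in atTop, w n ≤ B * (n : ℝ) ^ (-(2 * a) - 1)) :
    ∃ A : ℝ, 0 < A ∧ ∀ r : ℝ, 0 ≤ r → ∑' n : ℕ, w n * (1 - Real.cos (n * r)) ≤
      A * r ^ (2 * a) := by
  have hs := summable_of_eventually_le hw ha hB
  obtain ⟨ε, hε, h⟩ := mem_nhdsGT_iff_exists_Ioo_subset.mp
    (eventually_tsum_mul_one_sub_cos_le hw ha ha1 hB0 hB)
  have hε' : 0 < ε := hε
  have hU := upperConst_pos ha ha1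
  have hw0 : 0 ≤ ∑' n, w n := tsum_nonneg hw
  refine ⟨2 * upperConst a * B + 2 * (∑' n, w n) / ε ^ (2 * a), by positivity, fun r hr => ?_⟩
  rcases hr.eq_or_lt with rfl | hr0
  · simp [Real.zero_rpow (by linarith : 2 * a ≠ 0)]
  rw [add_mul]
  have hp : 0 < r ^ (2 * a) := by positivity
  rcases lt_or_ge r ε with h1 | h1
  · have := h ⟨hr0, h1⟩
    have h2 : 0 ≤ 2 * (∑' n, w n) / ε ^ (2 * a) * r ^ (2 * a) := by positivity
    simp only [Set.mem_ofPred_eq] at this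
    linarith
  · have h2 : ∑' n : ℕ, w n * (1 - Real.cos (n * r)) ≤ 2 * ∑' n, w n := by
      rw [← tsum_mul_left]
      refine (summable_mul_one_sub_cos hw hs r).tsum_le_tsum (fun n => ?_) (hs.mul_left 2)
      rw [mul_comm]
      exact mul_le_mul_of_nonneg_right (by linarith [Real.neg_one_le_cos (n * r)]) (hw n)
    have h3 : 2 * (∑' n, w n) ≤ 2 * (∑' n, w n) / ε ^ (2 * a) * r ^ (2 * a) := by
      rw [div_mul_eq_mul_div, le_div_iff₀ (by positivity)]
      have : ε ^ (2 * a) ≤ r ^ (2 * a) := Real.rpow_le_rpow hε'.le h1 (by linarith)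
      gcongr
    have h4 : 0 ≤ 2 * upperConst a * B * r ^ (2 * a) := by positivity
    linarith

end Series

/-! ### The law of the increments of the solution -/

section Field

variable {Ω : Type*} [MeasurableSpace Ω] {P : Measure Ω} {H : ℝ} {d : ℕ}
  {W : Fin d → ℕ → Fin 2 → ℝ≥0 → Ω → ℝ} {q : ℕ → ℝ}
  {u : ℝ≥0 → Real.Angle → Ω → EuclideanSpace ℝ (Fin d)}

/-- The law of the increments of the solution, in terms of the weights
`w n = 2 qₙ Var (∫₀ᵗ e^{-n²(t-s)} B(ds))`. -/
structure IncrementLaw (P : Measure Ω) (Y : Real.Angle → Ω → EuclideanSpace ℝ (Fin d))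
    (w : ℕ → ℝ) : Prop where
  memLp : ∀ x, MemLp (Y x) 2 P
  hasSum : ∀ x y i, HasSum (fun n : ℕ => w n * (1 - Real.cos (n * ‖x - y‖)))
    (∫ ω, (Y x ω i - Y y ω i) ^ 2 ∂P)
  subgaussian : ∀ x y i, HasSubgaussianMGF (fun ω => Y x ω i - Y y ω i)
    (∫ ω, (Y x ω i - Y y ω i) ^ 2 ∂P).toNNReal P

theorem MeasureTheory.MemLp.euclideanSpace_apply {X : Ω → EuclideanSpace ℝ (Fin d)}
    (hX : MemLp X 2 P) (i : Fin d) : MemLp (fun ω => X ω i) 2 P :=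
  hX.of_le ((EuclideanSpace.proj (𝕜 := ℝ) i).continuous.comp_aestronglyMeasurable hX.1)
    (ae_of_all _ fun ω => PiLp.norm_apply_le (X ω) i)

/-- By independence of the modes the variance of a coordinate of the increment is
`∑ qₙ Vₙ ((cos nx - cos ny)² + (sin nx - sin ny)²) = ∑ 2 qₙ Vₙ (1 - cos (n (x - y)))`, where `Vₙ`,
the variance of the Wiener integral of frequency `n`, is of order `n ^ (-4H)`. -/
theorem IsMildSolution.exists_incrementLaw (hu : IsMildSolution P q W u) (hq : ∀ n, 0 ≤ q n)
    (hW : IsFBMFamily P H W) (hH : 0 < H) (hH1 : H < 1) (hd : 1 ≤ d) {t : ℝ≥0} {t₀ : ℝ}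
    (ht₀ : 0 < t₀) (ht : t₀ ≤ t) :
    ∃ w : ℕ → ℝ, (∀ n, 0 ≤ w n) ∧
      (∀ n, n ≠ 0 → t₀ ^ (2 * H) * Real.exp (-4 * t₀) * (q n * (n : ℝ) ^ (-(4 * H))) ≤ w n) ∧
      (∀ n, n ≠ 0 → w n ≤ 32 * (q n * (n : ℝ) ^ (-(4 * H)))) ∧ IncrementLaw P (u t) w := by
  obtain ⟨hu2, I, hI, hlim⟩ := hu
  set J : Fin d × ℕ × Fin 2 → Ω → ℝ := fun a => I a.1 a.2.1 a.2.2 t with hJdef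
  have hJ : IsModeFamily P W t J :=
    ⟨fun a => (hI _ _ _ t).1, fun a => (hI _ _ _ t).tendsto_riemannSum⟩
  have i₀ : Fin d := ⟨0, hd⟩
  set V : ℕ → ℝ := fun n => ∫ ω, J (i₀, n, 0) ω ^ 2 ∂P with hV
  have hV0 : ∀ n, 0 ≤ V n := fun n => integral_nonneg fun ω => sq_nonneg _
  have hw : ∀ n, 0 ≤ 2 * q n * V n := fun n => mul_nonneg (by linarith [hq n]) (hV0 n)
  -- the coefficient of the mode `a` in the increment of the field between `x` and `y`
  set κ : Real.Angle → Real.Angle → Fin d × ℕ × Fin 2 → ℝ := fun x y a => √(q a.2.1) *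
    (if a.2.2 = 0 then Real.Angle.cos (a.2.1 • x) - Real.Angle.cos (a.2.1 • y)
      else Real.Angle.sin (a.2.1 • x) - Real.Angle.sin (a.2.1 • y)) with hκ
  set s : Fin d → ℕ → Finset (Fin d × ℕ × Fin 2) := fun i M =>
    {i} ×ˢ (Finset.range M ×ˢ Finset.univ) with hs
  set Z : Real.Angle → Real.Angle → Fin d → ℕ → Ω → ℝ := fun x y i M ω =>
    ∑ a ∈ s i M, κ x y a * J a ω with hZ
  have hZ2 : ∀ x y i M, MemLp (Z x y i M) 2 P := fun x y i M =>
    memLp_finsetSum _ fun a _ => (hJ.memLp a).const_mul _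
  have hU : ∀ x y i, MemLp (fun ω => u t x ω i - u t y ω i) 2 P := fun x y i =>
    ((hu2 t x).euclideanSpace_apply i).sub ((hu2 t y).euclideanSpace_apply i)
  have hS2 : ∀ x i M, MemLp (fun ω => ∑ n ∈ Finset.range M, √(q n) *
      (Real.Angle.cos (n • x) * I i n 0 t ω + Real.Angle.sin (n • x) * I i n 1 t ω)) 2 P :=
    fun x i M => memLp_finsetSum _ fun n _ =>
      (((hJ.memLp (i, n, 0)).const_mul _).add ((hJ.memLp (i, n, 1)).const_mul _)).const_mul _
  have hZlim : ∀ x y i, Tendsto (fun M => eLpNorm (fun ω =>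
      Z x y i M ω - (u t x ω i - u t y ω i)) 2 P) atTop (𝓝 0) := by
    intro x y i
    have h0 := (hlim t y i).add (hlim t x i)
    rw [add_zero] at h0
    refine tendsto_of_tendsto_of_tendsto_of_le_of_le tendsto_const_nhds h0 (fun _ => zero_le)
      fun M => ?_
    refine le_trans (le_of_eq ?_) (eLpNorm_sub_le
      (((hu2 t y).euclideanSpace_apply i).sub (hS2 y i M)).1
      (((hu2 t x).euclideanSpace_apply i).sub (hS2 x i M)).1 one_le_two)
    congr 1
    funext ω
    simp only [hZ, hs, hκ, hJdef, Finset.sum_product, Finset.sum_singleton, Fin.sum_univ_two,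
      Pi.sub_apply, if_true, if_neg (one_ne_zero (α := Fin 2))]
    have h1 : ∑ n ∈ Finset.range M, (√(q n) * (Real.Angle.cos (n • x) - Real.Angle.cos (n • y)) *
          I i n 0 t ω + √(q n) * (Real.Angle.sin (n • x) - Real.Angle.sin (n • y)) * I i n 1 t ω) =
        ∑ n ∈ Finset.range M, √(q n) * (Real.Angle.cos (n • x) * I i n 0 t ω +
          Real.Angle.sin (n • x) * I i n 1 t ω) -
        ∑ n ∈ Finset.range M, √(q n) * (Real.Angle.cos (n • y) * I i n 0 t ω +
          Real.Angle.sin (n • y) * I i n 1 t ω) := by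
      rw [← Finset.sum_sub_distrib]
      exact Finset.sum_congr rfl fun n _ => by ring
    rw [h1]
    ring
  have hvar : ∀ x y i M, ∑ a ∈ s i M, κ x y a ^ 2 * ∫ ω, J a ω ^ 2 ∂P =
      ∑ n ∈ Finset.range M, 2 * q n * V n * (1 - Real.cos (n * ‖x - y‖)) := by
    intro x y i M
    simp only [hs, Finset.sum_product, Finset.sum_singleton, Fin.sum_univ_two]
    refine Finset.sum_congr rfl fun n _ => ?_
    rw [hJ.integral_sq_eq hW hH i i₀ n 0 0, hJ.integral_sq_eq hW hH i i₀ n 1 0, ← add_mul]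
    simp only [hκ, if_true, if_neg (one_ne_zero (α := Fin 2)), mul_pow, Real.sq_sqrt (hq n)]
    rw [← mul_add, Real.Angle.sq_cos_sub_add_sq_sin_sub, ← smul_sub,
      Real.Angle.cos_nsmul_eq_cos_norm]
    ring
  have hcos : ∀ r : ℝ, ∀ n : ℕ, 0 ≤ 2 * q n * V n * (1 - Real.cos (n * r)) := fun r n =>
    mul_nonneg (hw n) (by linarith [Real.cos_le_one (n * r)])
  have htend : ∀ x y i, Tendsto (fun M => ∑ n ∈ Finset.range M,
      2 * q n * V n * (1 - Real.cos (n * ‖x - y‖))) atTop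
      (𝓝 (∫ ω, (u t x ω i - u t y ω i) ^ 2 ∂P)) := by
    intro x y i
    have := tendsto_integral_mul_of_tendsto_eLpNorm (hZ2 x y i) (hZ2 x y i) (hU x y i) (hU x y i)
      (hZlim x y i) (hZlim x y i)
    simp only [← sq] at this
    refine this.congr fun M => ?_
    rw [← hvar x y i M]
    exact hJ.integral_sum_sq hW (s i M) (κ x y)
  refine ⟨fun n => 2 * q n * V n, hw, fun n hn => ?_, fun n hn => ?_, fun x => hu2 t x,
    fun x y i => ?_, fun x y i => ?_⟩
  · have := mul_le_mul_of_nonneg_left (hJ.le_integral_sq hW hH ht₀ ht (a := (i₀, n, 0)) hn)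
      (show 0 ≤ 2 * q n by linarith [hq n])
    refine le_trans (le_of_eq ?_) this
    ring
  · have := mul_le_mul_of_nonneg_left (hJ.integral_sq_le hW hH hH1 (a := (i₀, n, 0)) hn)
      (show 0 ≤ 2 * q n by linarith [hq n])
    refine this.trans (le_of_eq ?_)
    ring
  · exact (hasSum_iff_tendsto_nat_of_nonneg (hcos _) _).mpr (htend x y i)
  · refine hasSubgaussianMGF_of_tendsto_eLpNorm (Eventually.of_forall fun M =>
      hJ.hasSubgaussianMGF_sum hW hH (s i M) (κ x y)) (hZ2 x y i) (hU x y i) (hZlim x y i) ?_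
    have : ∀ M, ∑ a ∈ s i M, (κ x y a ^ 2 * ∫ ω, J a ω ^ 2 ∂P).toNNReal =
        (∑ n ∈ Finset.range M, 2 * q n * V n * (1 - Real.cos (n * ‖x - y‖))).toNNReal := by
      intro M
      rw [← hvar x y i M, Real.toNNReal_sum_of_nonneg]
      exact fun a _ => mul_nonneg (sq_nonneg _) (integral_nonneg fun ω => sq_nonneg _)
    simp only [this]
    exact (continuous_real_toNNReal.tendsto _).comp (htend x y i)

theorem IncrementLaw.integral_norm_sub_sq {Y : Real.Angle → Ω → EuclideanSpace ℝ (Fin d)}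
    {w : ℕ → ℝ} (hY : IncrementLaw P Y w) (x y : Real.Angle) :
    ∫ ω, ‖Y x ω - Y y ω‖ ^ 2 ∂P = d * ∑' n : ℕ, w n * (1 - Real.cos (n * ‖x - y‖)) := by
  have h1 : ∀ ω, ‖Y x ω - Y y ω‖ ^ 2 = ∑ i, (Y x ω i - Y y ω i) ^ 2 := by
    intro ω
    rw [EuclideanSpace.norm_sq_eq]
    simp
  simp only [h1]
  rw [integral_finsetSum]
  · simp only [← (hY.hasSum x y _).tsum_eq, Finset.sum_const, Finset.card_univ, Fintype.card_fin,
      nsmul_eq_mul]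
  · exact fun i _ => (((hY.memLp x).euclideanSpace_apply i).sub
      ((hY.memLp y).euclideanSpace_apply i)).integrable_sq

end Field

/-! ### Chaining along dyadic numbers -/

section Chaining

/-- The largest dyadic number of level `m` below `s`. -/
noncomputable def dyadicFloor (m : ℕ) (s : ℝ) : ℝ := (⌊2 ^ m * s⌋ : ℝ) / 2 ^ m

theorem dyadicFloor_add_int (m : ℕ) (s : ℝ) (k : ℤ) :
    dyadicFloor m (s + k) = dyadicFloor m s + k := by
  have h : (2 : ℝ) ^ m * (s + k) = 2 ^ m * s + ((2 ^ m * k : ℤ) : ℝ) := by push_cast; ring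
  unfold dyadicFloor
  rw [h, Int.floor_add_intCast]
  push_cast
  field_simp

theorem abs_dyadicFloor_sub_le (m : ℕ) (s : ℝ) : |dyadicFloor m s - s| ≤ 1 / 2 ^ m := by
  have h0 : (0 : ℝ) < 2 ^ m := by positivity
  have h1 := Int.floor_le (2 ^ m * s)
  have h2 := Int.lt_floor_add_one (2 ^ m * s)
  have h3 : dyadicFloor m s - s = (⌊2 ^ m * s⌋ - 2 ^ m * s) / 2 ^ m := by
    unfold dyadicFloor; field_simp
  rw [h3, abs_div, abs_of_pos h0]
  gcongr
  rw [abs_le]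
  constructor <;> linarith

variable {E : Type*} [NormedAddCommGroup E] {f : ℝ → E} {L : ℕ → ℝ} {m₀ : ℕ}

theorem norm_dyadicFloor_succ_sub_le (hL : ∀ m, 0 ≤ L m)
    (hf : ∀ m, m₀ ≤ m → ∀ j : ℤ, ‖f ((j + 1) / 2 ^ m) - f (j / 2 ^ m)‖ ≤ L m) {m : ℕ}
    (hm : m₀ ≤ m) (s : ℝ) :
    ‖f (dyadicFloor (m + 1) s) - f (dyadicFloor m s)‖ ≤ L (m + 1) := by
  set j := ⌊2 ^ m * s⌋ with hj
  have h1 := Int.floor_le (2 ^ m * s)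
  have h2 := Int.lt_floor_add_one (2 ^ m * s)
  have e0 : dyadicFloor m s = ((2 * j : ℤ) : ℝ) / 2 ^ (m + 1) := by
    unfold dyadicFloor; rw [← hj, pow_succ]; push_cast; field_simp
  have e1 : (2 : ℝ) ^ (m + 1) * s = 2 * (2 ^ m * s) := by ring
  have h3 : 2 * j ≤ ⌊(2 : ℝ) ^ (m + 1) * s⌋ := by
    rw [Int.le_floor, e1]; push_cast; linarith
  have h4 : ⌊(2 : ℝ) ^ (m + 1) * s⌋ < 2 * j + 2 := by
    rw [Int.floor_lt, e1]; push_cast; linarith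
  rcases (show ⌊(2 : ℝ) ^ (m + 1) * s⌋ = 2 * j ∨ ⌊(2 : ℝ) ^ (m + 1) * s⌋ = 2 * j + 1 by omega)
    with h | h
  · rw [e0, dyadicFloor, h, sub_self, norm_zero]; exact hL _
  · have := hf (m + 1) (by omega) (2 * j)
    rw [e0, dyadicFloor, h]
    push_cast at this ⊢
    exact this

theorem norm_dyadicFloor_sub_le (hL : ∀ m, 0 ≤ L m)
    (hf : ∀ m, m₀ ≤ m → ∀ j : ℤ, ‖f ((j + 1) / 2 ^ m) - f (j / 2 ^ m)‖ ≤ L m) {m : ℕ}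
    (hm : m₀ ≤ m) {s t : ℝ} (hst : |s - t| ≤ 1 / 2 ^ m) :
    ‖f (dyadicFloor m s) - f (dyadicFloor m t)‖ ≤ L m := by
  wlog h : t ≤ s generalizing s t
  · rw [norm_sub_rev]
    exact this (by rwa [abs_sub_comm]) (le_of_not_ge h)
  have h0 : (0 : ℝ) < 2 ^ m := by positivity
  rw [abs_of_nonneg (sub_nonneg.mpr h), le_div_iff₀ h0] at hst
  have h1 : ⌊(2 : ℝ) ^ m * t⌋ ≤ ⌊(2 : ℝ) ^ m * s⌋ := Int.floor_mono (by gcongr)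
  have h2 : ⌊(2 : ℝ) ^ m * s⌋ ≤ ⌊(2 : ℝ) ^ m * t⌋ + 1 := by
    rw [← Int.floor_add_one]; exact Int.floor_mono (by linarith)
  rcases (show ⌊(2 : ℝ) ^ m * s⌋ = ⌊(2 : ℝ) ^ m * t⌋ ∨
    ⌊(2 : ℝ) ^ m * s⌋ = ⌊(2 : ℝ) ^ m * t⌋ + 1 by omega) with h | h
  · rw [dyadicFloor, dyadicFloor, h, sub_self, norm_zero]; exact hL _
  · have := hf m hm ⌊(2 : ℝ) ^ m * t⌋
    rw [dyadicFloor, dyadicFloor, h]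
    push_cast
    exact this

/-- The limit of `f` along the dyadic approximations from below. -/
noncomputable def dyadicLimit (f : ℝ → E) (s : ℝ) : E :=
  limUnder atTop fun m => f (dyadicFloor m s)

variable [CompleteSpace E]

theorem tendsto_dyadicLimit (hL : ∀ m, 0 ≤ L m) (hLs : Summable L)
    (hf : ∀ m, m₀ ≤ m → ∀ j : ℤ, ‖f ((j + 1) / 2 ^ m) - f (j / 2 ^ m)‖ ≤ L m) (s : ℝ) :
    Tendsto (fun m => f (dyadicFloor m s)) atTop (𝓝 (dyadicLimit f s)) := by
  have h : CauchySeq fun k => f (dyadicFloor (k + m₀) s) :=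
    cauchySeq_of_dist_le_of_summable (fun k => L (k + m₀ + 1)) (fun k => by
      rw [dist_comm, dist_eq_norm, Nat.succ_eq_add_one, show k + 1 + m₀ = k + m₀ + 1 by ring]
      exact norm_dyadicFloor_succ_sub_le hL hf (Nat.le_add_left _ _) s)
      ((summable_nat_add_iff (m₀ + 1)).mpr hLs)
  obtain ⟨y, hy⟩ := cauchySeq_tendsto_of_complete h
  have := (tendsto_add_atTop_iff_nat (f := fun m => f (dyadicFloor m s)) m₀).mp hy
  rwa [dyadicLimit, this.limUnder_eq]

theorem norm_sub_dyadicLimit_le (hL : ∀ m, 0 ≤ L m) (hLs : Summable L)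
    (hf : ∀ m, m₀ ≤ m → ∀ j : ℤ, ‖f ((j + 1) / 2 ^ m) - f (j / 2 ^ m)‖ ≤ L m) {m : ℕ}
    (hm : m₀ ≤ m) (s : ℝ) :
    ‖f (dyadicFloor m s) - dyadicLimit f s‖ ≤ ∑' k, L (m + 1 + k) := by
  have h1 := (tendsto_add_atTop_iff_nat m).mpr (tendsto_dyadicLimit hL hLs hf s)
  have := dist_le_tsum_of_dist_le_of_tendsto₀ (fun k => L (m + 1 + k)) (fun k => by
      rw [dist_comm, dist_eq_norm, Nat.succ_eq_add_one, show k + 1 + m = k + m + 1 by ring,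
        show m + 1 + k = k + m + 1 by ring]
      exact norm_dyadicFloor_succ_sub_le hL hf (by omega) s)
      (((summable_nat_add_iff (m + 1)).mpr hLs).congr fun k => by rw [add_comm]) h1
  simpa [dist_eq_norm] using this

theorem norm_dyadicLimit_sub_le (hL : ∀ m, 0 ≤ L m) (hLs : Summable L)
    (hf : ∀ m, m₀ ≤ m → ∀ j : ℤ, ‖f ((j + 1) / 2 ^ m) - f (j / 2 ^ m)‖ ≤ L m) {m : ℕ}
    (hm : m₀ ≤ m) {s t : ℝ} (hst : |s - t| ≤ 1 / 2 ^ m) :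
    ‖dyadicLimit f s - dyadicLimit f t‖ ≤ 2 * ∑' k, L (m + k) := by
  have hs := norm_sub_dyadicLimit_le hL hLs hf hm s
  have ht := norm_sub_dyadicLimit_le hL hLs hf hm t
  have h := norm_dyadicFloor_sub_le hL hf hm hst
  have hsum : ∑' k, L (m + k) = L m + ∑' k, L (m + 1 + k) := by
    rw [((summable_nat_add_iff m).mpr hLs |>.congr fun k => by rw [add_comm]).tsum_eq_zero_add]
    simp only [add_zero]
    congr 1
    exact tsum_congr fun k => by congr 1; ring
  have tri : ‖dyadicLimit f s - dyadicLimit f t‖ ≤ ‖f (dyadicFloor m s) - dyadicLimit f s‖ +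
      ‖f (dyadicFloor m s) - f (dyadicFloor m t)‖ + ‖f (dyadicFloor m t) - dyadicLimit f t‖ := by
    have e : dyadicLimit f s - dyadicLimit f t = -(f (dyadicFloor m s) - dyadicLimit f s) +
      (f (dyadicFloor m s) - f (dyadicFloor m t)) + (f (dyadicFloor m t) - dyadicLimit f t) := by
      abel
    rw [e]
    refine (norm_add_le _ _).trans ?_
    gcongr
    refine (norm_add_le _ _).trans ?_
    rw [norm_neg]
  linarith [hL m]

end Chaining

/-! ### The modulus of continuity produced by chaining -/

section Thresholds

/-- The size of the increments of level `m` in the chaining argument. -/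
noncomputable def level (K a : ℝ) (m : ℕ) : ℝ := K * √m * (1 / 2 ^ m : ℝ) ^ a

theorem level_nonneg {K : ℝ} (hK : 0 ≤ K) (a : ℝ) (m : ℕ) : 0 ≤ level K a m := by
  unfold level; positivity

theorem half_pow_rpow (m : ℕ) (a : ℝ) : (1 / 2 ^ m : ℝ) ^ a = ((1 / 2 : ℝ) ^ a) ^ m := by
  rw [← Real.rpow_natCast ((1 / 2 : ℝ) ^ a), ← Real.rpow_mul (by norm_num), mul_comm,
    Real.rpow_mul (by norm_num), Real.rpow_natCast, one_div_pow]

theorem summable_sqrt_mul_rpow {a : ℝ} (ha : 0 < a) :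
    Summable fun k : ℕ => √(k + 1) * (1 / 2 ^ k : ℝ) ^ a := by
  have hr0 : (0 : ℝ) ≤ (1 / 2 : ℝ) ^ a := by positivity
  have hr1 : (1 / 2 : ℝ) ^ a < 1 := Real.rpow_lt_one (by norm_num) (by norm_num) ha
  have h1 := summable_pow_mul_geometric_of_norm_lt_one 1 (r := (1 / 2 : ℝ) ^ a) (by
    rwa [Real.norm_of_nonneg hr0])
  have h2 := summable_geometric_of_lt_one hr0 hr1
  refine Summable.of_nonneg_of_le (fun k => by positivity) (fun k => ?_) (h1.add h2)
  rw [half_pow_rpow]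
  have : √((k : ℝ) + 1) ≤ k + 1 := by
    rw [Real.sqrt_le_left (by positivity)]
    nlinarith [k.cast_nonneg (α := ℝ)]
  calc _ ≤ ((k : ℝ) + 1) * ((1 / 2 : ℝ) ^ a) ^ k := by gcongr
    _ = _ := by ring

/-- Since `m + k ≤ m (k + 1)`, the levels `m, m + 1, …` add up to a multiple of the first. -/
theorem level_add_le {K a : ℝ} (hK : 0 ≤ K) {m : ℕ} (hm : 1 ≤ m) (k : ℕ) :
    level K a (m + k) ≤ level K a m * (√(k + 1) * (1 / 2 ^ k : ℝ) ^ a) := by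
  have h1 : √((m + k : ℕ) : ℝ) ≤ √m * √(k + 1) := by
    rw [← Real.sqrt_mul (by positivity)]
    refine Real.sqrt_le_sqrt ?_
    have hm' : (1 : ℝ) ≤ m := by exact_mod_cast hm
    push_cast
    nlinarith [mul_nonneg (k.cast_nonneg (α := ℝ)) (sub_nonneg.mpr hm')]
  have h2 : (1 / 2 ^ (m + k) : ℝ) ^ a = (1 / 2 ^ m : ℝ) ^ a * (1 / 2 ^ k : ℝ) ^ a := by
    rw [half_pow_rpow, half_pow_rpow, half_pow_rpow, pow_add]
  unfold level
  rw [h2]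
  calc _ ≤ K * (√m * √(k + 1)) * ((1 / 2 ^ m : ℝ) ^ a * (1 / 2 ^ k : ℝ) ^ a) := by gcongr
    _ = _ := by ring

theorem summable_level {K a : ℝ} (hK : 0 ≤ K) (ha : 0 < a) : Summable (level K a) := by
  rw [← summable_nat_add_iff 1]
  refine Summable.of_nonneg_of_le (fun k => level_nonneg hK a _) (fun k => ?_)
    ((summable_sqrt_mul_rpow ha).mul_left (level K a 1))
  rw [add_comm]
  exact level_add_le hK le_rfl k

theorem tsum_level_le {K a : ℝ} (hK : 0 ≤ K) (ha : 0 < a) {m : ℕ} (hm : 1 ≤ m) :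
    ∑' k, level K a (m + k) ≤
      level K a m * ∑' k : ℕ, √((k : ℝ) + 1) * (1 / 2 ^ k : ℝ) ^ a := by
  rw [← tsum_mul_left]
  exact (((summable_nat_add_iff m).mpr (summable_level hK ha)).congr fun k => by
    rw [add_comm]).tsum_le_tsum (level_add_le hK hm) ((summable_sqrt_mul_rpow ha).mul_left _)

theorem level_le {K a r : ℝ} (hK : 0 ≤ K) (ha : 0 < a) {m : ℕ} (hm : 1 ≤ m)
    (h1 : (1 / 2 : ℝ) ^ (m + 1) < r) (h2 : r ≤ (1 / 2 : ℝ) ^ m) :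
    level K a m ≤ K * 2 * 2 ^ a * (r ^ a * √(Real.log (1 / r))) := by
  have hr : 0 < r := lt_trans (by positivity) h1
  have h3 : (1 / 2 ^ m : ℝ) ^ a ≤ 2 ^ a * r ^ a := by
    rw [← Real.mul_rpow (by norm_num) hr.le]
    refine Real.rpow_le_rpow (by positivity) ?_ ha.le
    rw [pow_succ, one_div_pow] at h1
    linarith
  have h4 : √m ≤ 2 * √(Real.log (1 / r)) := by
    have h5 : (m : ℝ) * Real.log 2 ≤ Real.log (1 / r) := by
      rw [← Real.log_pow]
      refine Real.log_le_log (by positivity) ?_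
      rw [le_div_iff₀ hr]
      calc (2 : ℝ) ^ m * r ≤ 2 ^ m * (1 / 2) ^ m := by gcongr
        _ = 1 := by rw [← mul_pow]; norm_num
    have h6 : (m : ℝ) ≤ 4 * Real.log (1 / r) := by
      have := Real.log_two_gt_d9
      have hm' : (0 : ℝ) ≤ m := by positivity
      nlinarith
    calc √m ≤ √(2 ^ 2 * Real.log (1 / r)) := Real.sqrt_le_sqrt (by linarith)
      _ = _ := by rw [Real.sqrt_mul (by norm_num), Real.sqrt_sq (by norm_num)]
  unfold level
  calc _ ≤ K * (2 * √(Real.log (1 / r))) * (2 ^ a * r ^ a) := by gcongr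
    _ = _ := by ring

/-- The constant in the modulus of continuity obtained by chaining. -/
noncomputable def modulusConst (K a : ℝ) : ℝ :=
  2 * (K * 2 * 2 ^ a) * ∑' k : ℕ, √((k : ℝ) + 1) * (1 / 2 ^ k : ℝ) ^ a

theorem modulusConst_pos {K a : ℝ} (hK : 0 < K) (ha : 0 < a) : 0 < modulusConst K a := by
  have : 0 < ∑' k : ℕ, √((k : ℝ) + 1) * (1 / 2 ^ k : ℝ) ^ a :=
    (summable_sqrt_mul_rpow ha).tsum_pos (fun k => by positivity) 0 (by simp)
  unfold modulusConst; positivity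

theorem exists_norm_dyadicLimit_sub_le {E : Type*} [NormedAddCommGroup E] [CompleteSpace E]
    {f : ℝ → E} {m₀ : ℕ} {K a : ℝ} (hK : 0 ≤ K) (ha : 0 < a)
    (hf : ∀ m, m₀ ≤ m → ∀ j : ℤ, ‖f ((j + 1) / 2 ^ m) - f (j / 2 ^ m)‖ ≤ level K a m) :
    ∃ ε : ℝ, 0 < ε ∧ ∀ s t r : ℝ, 0 < r → r < ε → |s - t| ≤ r →
      ‖dyadicLimit f s - dyadicLimit f t‖ ≤ modulusConst K a * (r ^ a * √(Real.log (1 / r))) := by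
  refine ⟨(1 / 2) ^ (m₀ + 1), by positivity, fun s t r hr hrε hst => ?_⟩
  have hr1 : r ≤ 1 := hrε.le.trans (pow_le_one₀ (by norm_num) (by norm_num))
  obtain ⟨m, hm1, hm2⟩ := exists_nat_pow_near_of_lt_one hr hr1 (by norm_num : (0 : ℝ) < 1 / 2)
    (by norm_num)
  have hm : m₀ + 1 ≤ m := by
    by_contra! h
    have : (1 / 2 : ℝ) ^ (m₀ + 1) ≤ (1 / 2) ^ (m + 1) :=
      pow_le_pow_of_le_one (by norm_num) (by norm_num) (by omega)
    linarith
  have h1 := norm_dyadicLimit_sub_le (level_nonneg hK a) (summable_level hK ha) hf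
    (m := m) (by omega) (s := s) (t := t) (hst.trans (by rwa [← one_div_pow]))
  have h2 := tsum_level_le hK ha (m := m) (by omega)
  have h3 := level_le hK ha (by omega) hm1 hm2
  have h0 : 0 ≤ ∑' k : ℕ, √((k : ℝ) + 1) * (1 / 2 ^ k : ℝ) ^ a :=
    tsum_nonneg fun k => by positivity
  calc _ ≤ _ := h1
    _ ≤ 2 * (level K a m * ∑' k : ℕ, √((k : ℝ) + 1) * (1 / 2 ^ k : ℝ) ^ a) := by gcongr
    _ ≤ 2 * (K * 2 * 2 ^ a * (r ^ a * √(Real.log (1 / r))) *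
        ∑' k : ℕ, √((k : ℝ) + 1) * (1 / 2 ^ k : ℝ) ^ a) := by gcongr
    _ = _ := by unfold modulusConst; ring

end Thresholds

/-! ### Lifting fields on the circle to the line -/

section Circle

variable {Ω E : Type*}

/-- The path of `Y` at `ω`, as a function on `ℝ` of period `1`. -/
noncomputable def circlePath (Y : Real.Angle → Ω → E) (ω : Ω) (s : ℝ) : E :=
  Y ((2 * Real.pi * s : ℝ) : Real.Angle) ω

theorem circlePath_add_int (Y : Real.Angle → Ω → E) (ω : Ω) (s : ℝ) (k : ℤ) :
    circlePath Y ω (s + k) = circlePath Y ω s := by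
  unfold circlePath
  congr 1
  exact Real.Angle.angle_eq_iff_two_pi_dvd_sub.mpr ⟨k, by ring⟩

variable [NormedAddCommGroup E]

/-- The limit of `Y` along the dyadic approximations from below. It does not refer to any
exponent, so that one modification serves for all Hölder exponents at once. -/
noncomputable def dyadicVersion (Y : Real.Angle → Ω → E) (x : Real.Angle) (ω : Ω) : E :=
  dyadicLimit (circlePath Y ω) (x.toReal / (2 * Real.pi))

theorem dyadicVersion_coe (Y : Real.Angle → Ω → E) (ω : Ω) (s : ℝ) :
    dyadicVersion Y ((2 * Real.pi * s : ℝ) : Real.Angle) ω = dyadicLimit (circlePath Y ω) s := by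
  obtain ⟨k, hk⟩ := Real.Angle.angle_eq_iff_two_pi_dvd_sub.mp
    (Real.Angle.coe_toReal ((2 * Real.pi * s : ℝ) : Real.Angle))
  have h : ((2 * Real.pi * s : ℝ) : Real.Angle).toReal / (2 * Real.pi) = s + k := by
    rw [div_eq_iff Real.two_pi_pos.ne']; linarith
  unfold dyadicVersion dyadicLimit
  rw [h]
  simp only [dyadicFloor_add_int, circlePath_add_int]

theorem coe_two_pi_mul_toReal_div (x : Real.Angle) :
    ((2 * Real.pi * (x.toReal / (2 * Real.pi)) : ℝ) : Real.Angle) = x := by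
  rw [mul_div_cancel₀ _ Real.two_pi_pos.ne', Real.Angle.coe_toReal]

theorem exists_lift (x y : Real.Angle) : ∃ s t : ℝ,
    ((2 * Real.pi * s : ℝ) : Real.Angle) = x ∧ ((2 * Real.pi * t : ℝ) : Real.Angle) = y ∧
    |s - t| ≤ ‖x - y‖ := by
  refine ⟨(y.toReal + (x - y).toReal) / (2 * Real.pi), y.toReal / (2 * Real.pi), ?_,
    coe_two_pi_mul_toReal_div y, ?_⟩
  · rw [mul_div_cancel₀ _ Real.two_pi_pos.ne', Real.Angle.coe_add, Real.Angle.coe_toReal,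
      Real.Angle.coe_toReal]
    abel
  · rw [← sub_div, add_sub_cancel_left, abs_div, abs_of_pos Real.two_pi_pos,
      ← Real.Angle.norm_eq_abs_toReal]
    exact div_le_self (norm_nonneg _) (by linarith [Real.pi_gt_three])

/-- A bound on the increments over `[j / 2^m, (j + 1) / 2^m]` for `0 ≤ j < 2^m` is enough, by
periodicity. -/
theorem norm_circlePath_sub_le_of_nat {Y : Real.Angle → Ω → E} {ω : Ω} {m : ℕ} {L : ℝ}
    (h : ∀ j : ℕ, j < 2 ^ m →
      ‖circlePath Y ω ((j + 1) / 2 ^ m) - circlePath Y ω (j / 2 ^ m)‖ ≤ L) (j : ℤ) :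
    ‖circlePath Y ω ((j + 1) / 2 ^ m) - circlePath Y ω (j / 2 ^ m)‖ ≤ L := by
  have h2 : (0 : ℤ) < 2 ^ m := by positivity
  have hmod := Int.emod_nonneg j h2.ne'
  obtain ⟨i, hi⟩ := Int.eq_ofNat_of_zero_le hmod
  have hlt : i < 2 ^ m := by
    have := Int.emod_lt_of_pos j h2
    rw [hi] at this
    exact_mod_cast this
  have hj : (j : ℝ) = i + 2 ^ m * ((j / 2 ^ m : ℤ) : ℝ) := by
    have := Int.emod_add_mul_ediv j (2 ^ m)
    rw [hi] at this
    exact_mod_cast this.symm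
  have e1 : (j : ℝ) / 2 ^ m = i / 2 ^ m + ((j / 2 ^ m : ℤ) : ℝ) := by
    rw [hj]; field_simp
  have e2 : ((j : ℝ) + 1) / 2 ^ m = (i + 1) / 2 ^ m + ((j / 2 ^ m : ℤ) : ℝ) := by
    rw [add_div, e1]; ring
  rw [e1, e2, circlePath_add_int, circlePath_add_int]
  exact h i hlt

end Circle

/-! ### Fields with sub-Gaussian increments -/

section Random

variable {Ω : Type*} [MeasurableSpace Ω] {P : Measure Ω} {d : ℕ}
  {Y : Real.Angle → Ω → EuclideanSpace ℝ (Fin d)} {A a : ℝ}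

/-- The increments of the coordinates of `Y` are sub-Gaussian, with variance proxy
`A ‖x - y‖^(2a)`. -/
def SubgaussianIncrements (P : Measure Ω) (Y : Real.Angle → Ω → EuclideanSpace ℝ (Fin d))
    (A a : ℝ) : Prop :=
  ∀ x y i, HasSubgaussianMGF (fun ω => Y x ω i - Y y ω i) (A * ‖x - y‖ ^ (2 * a)).toNNReal P

/-- The factor for which increments of level `m` exceed `level (tailConst d A a) a m` with
probability at most `2 d e^{-2m}`. -/
noncomputable def tailConst (d : ℕ) (A a : ℝ) : ℝ := 2 * d * √A * (2 * Real.pi) ^ a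

theorem EuclideanSpace.norm_le_sum_abs (v : EuclideanSpace ℝ (Fin d)) : ‖v‖ ≤ ∑ i, |v i| := by
  rw [EuclideanSpace.norm_eq, Real.sqrt_le_left (Finset.sum_nonneg fun i _ => abs_nonneg _)]
  exact Finset.sum_sq_le_sq_sum_of_nonneg fun i _ => abs_nonneg _

/-- The Chernoff bound for each coordinate: a coordinate exceeds the threshold `ε` below, where
`ε² = 4 m c` for the variance proxy `c`, with probability at most `2 e^{-2m}`. -/
theorem SubgaussianIncrements.measure_lt_norm_sub_le [IsProbabilityMeasure P]
    (hY : SubgaussianIncrements P Y A a)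
    (hd : 1 ≤ d) (hA : 0 < A) (ha : 0 < a) {m : ℕ} {x y : Real.Angle}
    (hxy : ‖x - y‖ ≤ 2 * Real.pi / 2 ^ m) :
    P {ω | level (tailConst d A a) a m < ‖Y x ω - Y y ω‖} ≤
      ENNReal.ofReal (2 * d * Real.exp (-2 * m)) := by
  set c : ℝ := A * (2 * Real.pi / 2 ^ m) ^ (2 * a) with hc
  have hc0 : 0 < c := by positivity
  have hd0 : (0 : ℝ) < d := by exact_mod_cast hd
  set ε : ℝ := level (tailConst d A a) a m / d with hε
  have hε0 : 0 ≤ ε := div_nonneg (level_nonneg (by unfold tailConst; positivity) _ _) hd0.le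
  have hεc : ε ^ 2 = 4 * m * c := by
    have e1 : ((1 / 2 ^ m : ℝ) ^ a) ^ 2 * ((2 * Real.pi) ^ a) ^ 2 =
        (2 * Real.pi / 2 ^ m) ^ (2 * a) := by
      rw [← mul_pow, ← Real.mul_rpow (by positivity) (by positivity), ← Real.rpow_natCast,
        ← Real.rpow_mul (by positivity)]
      congr 1
      · ring
      · push_cast; ring
    have e2 : ε = 2 * √A * √m * ((1 / 2 ^ m : ℝ) ^ a * (2 * Real.pi) ^ a) := by
      rw [hε, level, tailConst]; field_simp
    rw [e2, hc, ← e1, mul_pow, mul_pow, mul_pow, mul_pow, Real.sq_sqrt hA.le,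
      Real.sq_sqrt (by positivity)]
    ring
  have hsub : ∀ i, HasSubgaussianMGF (fun ω => Y x ω i - Y y ω i) c.toNNReal P := fun i =>
    (hY x y i).mono (Real.toNNReal_le_toNNReal (by rw [hc]; gcongr))
  have hexp : Real.exp (-ε ^ 2 / (2 * c.toNNReal)) = Real.exp (-2 * m) := by
    rw [Real.coe_toNNReal _ hc0.le, hεc]
    congr 1
    field_simp
    ring
  have htail : ∀ i, P ({ω | ε ≤ Y x ω i - Y y ω i} ∪ {ω | ε ≤ -(Y x ω i - Y y ω i)}) ≤
      ENNReal.ofReal (2 * Real.exp (-2 * m)) := by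
    intro i
    have h1 := (hsub i).measure_ge_le hε0
    have h2 := (hsub i).neg.measure_ge_le hε0
    rw [hexp] at h1 h2
    refine (measure_union_le _ _).trans ?_
    rw [two_mul, ENNReal.ofReal_add (Real.exp_pos _).le (Real.exp_pos _).le]
    refine add_le_add ?_ ?_
    · rw [← ofReal_measureReal]; exact ENNReal.ofReal_le_ofReal h1
    · rw [← ofReal_measureReal]; exact ENNReal.ofReal_le_ofReal h2
  have hincl : {ω | level (tailConst d A a) a m < ‖Y x ω - Y y ω‖} ⊆
      ⋃ i : Fin d, ({ω | ε ≤ Y x ω i - Y y ω i} ∪ {ω | ε ≤ -(Y x ω i - Y y ω i)}) := by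
    intro ω hω
    by_contra hcon
    simp only [Set.mem_iUnion, Set.mem_union, Set.mem_ofPred_eq, not_exists, not_or, not_le]
      at hcon hω
    have h1 : ∑ i, |(Y x ω - Y y ω) i| ≤ ∑ _i : Fin d, ε := Finset.sum_le_sum fun i _ => by
      rw [PiLp.sub_apply, abs_le]
      constructor <;> linarith [(hcon i).1, (hcon i).2]
    rw [Finset.sum_const, Finset.card_univ, Fintype.card_fin, nsmul_eq_mul, hε,
      mul_div_cancel₀ _ hd0.ne'] at h1
    linarith [EuclideanSpace.norm_le_sum_abs (Y x ω - Y y ω)]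
  calc _ ≤ _ := measure_mono hincl
    _ ≤ ∑ i : Fin d, P ({ω | ε ≤ Y x ω i - Y y ω i} ∪ {ω | ε ≤ -(Y x ω i - Y y ω i)}) :=
        measure_iUnion_fintype_le _ _
    _ ≤ ∑ _i : Fin d, ENNReal.ofReal (2 * Real.exp (-2 * m)) := Finset.sum_le_sum fun i _ => htail i
    _ = _ := by
        rw [Finset.sum_const, Finset.card_univ, Fintype.card_fin, nsmul_eq_mul,
          ← ENNReal.ofReal_natCast, ← ENNReal.ofReal_mul hd0.le]
        congr 1; ring

theorem exp_neg_two_mul_le (m : ℕ) : Real.exp (-2 * m) ≤ (1 / 4 : ℝ) ^ m := by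
  rw [mul_comm, Real.exp_nat_mul]
  refine pow_le_pow_left₀ (Real.exp_pos _).le ?_ m
  have h1 : 1 / 2 ≥ Real.exp (-1) := by
    rw [Real.exp_neg, one_div]
    exact inv_anti₀ (by norm_num) (by linarith [Real.add_one_le_exp (1 : ℝ)])
  have h2 : Real.exp (-2) = Real.exp (-1) * Real.exp (-1) := by rw [← Real.exp_add]; norm_num
  nlinarith [Real.exp_pos (-1)]

/-- Borel-Cantelli: the `2^m` increments of level `m` exceed their threshold with total probability
at most `2 d (2 e^{-2})^m`. -/
theorem SubgaussianIncrements.ae_eventually_forall_norm_circlePath_sub_le [IsProbabilityMeasure P]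
    (hY : SubgaussianIncrements P Y A a) (hd : 1 ≤ d) (hA : 0 < A) (ha : 0 < a) :
    ∀ᵐ ω ∂P, ∃ m₀ : ℕ, ∀ m, m₀ ≤ m → ∀ j : ℤ,
      ‖circlePath Y ω ((j + 1) / 2 ^ m) - circlePath Y ω (j / 2 ^ m)‖ ≤
        level (tailConst d A a) a m := by
  set bad : ℕ → Set Ω := fun m => ⋃ j ∈ Finset.range (2 ^ m),
    {ω | level (tailConst d A a) a m <
      ‖circlePath Y ω ((j + 1) / 2 ^ m) - circlePath Y ω (j / 2 ^ m)‖} with hbad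
  have hP : ∀ m, P (bad m) ≤ ENNReal.ofReal (2 * d * (1 / 2) ^ m) := by
    intro m
    calc P (bad m) ≤ ∑ j ∈ Finset.range (2 ^ m), P {ω | level (tailConst d A a) a m <
          ‖circlePath Y ω ((j + 1) / 2 ^ m) - circlePath Y ω (j / 2 ^ m)‖} :=
          measure_biUnion_finset_le _ _
      _ ≤ ∑ j ∈ Finset.range (2 ^ m), ENNReal.ofReal (2 * d * Real.exp (-2 * m)) := by
          refine Finset.sum_le_sum fun j _ => hY.measure_lt_norm_sub_le hd hA ha ?_
          rw [← Real.Angle.coe_sub]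
          refine (Real.Angle.norm_coe_le _).trans (le_of_eq ?_)
          rw [show 2 * Real.pi * (((j : ℝ) + 1) / 2 ^ m) - 2 * Real.pi * (j / 2 ^ m) =
            2 * Real.pi / 2 ^ m by ring, abs_of_pos (by positivity)]
      _ = ENNReal.ofReal (2 ^ m * (2 * d * Real.exp (-2 * m))) := by
          rw [Finset.sum_const, Finset.card_range, nsmul_eq_mul, ← ENNReal.ofReal_natCast,
            ← ENNReal.ofReal_mul (by positivity)]
          push_cast; rfl
      _ ≤ _ := by
          refine ENNReal.ofReal_le_ofReal ?_
          calc _ ≤ 2 ^ m * (2 * d * (1 / 4 : ℝ) ^ m) := by gcongr; exact exp_neg_two_mul_le m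
            _ = 2 * d * ((2 : ℝ) ^ m * (1 / 4) ^ m) := by ring
            _ = _ := by rw [← mul_pow]; norm_num
  have hsum : ∑' m, P (bad m) ≠ ⊤ := by
    refine ne_top_of_le_ne_top ?_ (ENNReal.tsum_le_tsum hP)
    exact ((summable_geometric_two).mul_left (2 * (d : ℝ))).tsum_ofReal_ne_top
  filter_upwards [ae_eventually_notMem hsum] with ω hω
  obtain ⟨m₀, hm₀⟩ := eventually_atTop.mp hω
  refine ⟨m₀, fun m hm => norm_circlePath_sub_le_of_nat fun j hj => ?_⟩
  have := hm₀ m hm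
  simp only [hbad, Set.mem_iUnion, Set.mem_ofPred_eq, not_exists, not_lt] at this
  exact this j (Finset.mem_range.mpr hj)

theorem SubgaussianIncrements.hasUniformModulus_dyadicVersion [IsProbabilityMeasure P]
    (hY : SubgaussianIncrements P Y A a) (hd : 1 ≤ d) (hA : 0 < A) (ha : 0 < a) :
    HasUniformModulus P (dyadicVersion Y) (fun r => r ^ a * √(Real.log (1 / r))) := by
  have hd0 : (0 : ℝ) < d := by exact_mod_cast hd
  have hK : 0 < tailConst d A a := by unfold tailConst; positivity
  refine ⟨modulusConst (tailConst d A a) a, modulusConst_pos hK ha, ?_⟩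
  filter_upwards [hY.ae_eventually_forall_norm_circlePath_sub_le hd hA ha] with ω ⟨m₀, hm₀⟩
  obtain ⟨ε, hε, h⟩ := exists_norm_dyadicLimit_sub_le hK.le ha hm₀
  refine ⟨ε, hε, fun x y hxy hxyε => ?_⟩
  obtain ⟨s, t, hs, ht, hst⟩ := exists_lift x y
  have := h s t _ hxy hxyε hst
  rwa [← dyadicVersion_coe, ← dyadicVersion_coe, hs, ht] at this

/-- The same tail bound shows that `Y` converges to `Y x` along the dyadic approximations of `x`. -/
theorem SubgaussianIncrements.dyadicVersion_ae_eq [IsProbabilityMeasure P]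
    (hY : SubgaussianIncrements P Y A a) (hd : 1 ≤ d) (hA : 0 < A) (ha : 0 < a) (x : Real.Angle) :
    dyadicVersion Y x =ᵐ[P] Y x := by
  have hd0 : (0 : ℝ) < d := by exact_mod_cast hd
  have hK : 0 ≤ tailConst d A a := by unfold tailConst; positivity
  set s := x.toReal / (2 * Real.pi) with hs
  set bad : ℕ → Set Ω := fun m => {ω | level (tailConst d A a) a m <
      ‖Y ((2 * Real.pi * dyadicFloor m s : ℝ) : Real.Angle) ω - Y x ω‖} with hbad
  have hP : ∀ m, P (bad m) ≤ ENNReal.ofReal (2 * d * (1 / 4) ^ m) := by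
    intro m
    refine (hY.measure_lt_norm_sub_le hd hA ha ?_).trans (ENNReal.ofReal_le_ofReal (by
      gcongr; exact exp_neg_two_mul_le m))
    conv_lhs => rw [← coe_two_pi_mul_toReal_div x, ← Real.Angle.coe_sub]
    refine (Real.Angle.norm_coe_le _).trans ?_
    rw [← mul_sub, abs_mul, abs_of_pos Real.two_pi_pos]
    exact (mul_le_mul_of_nonneg_left (abs_dyadicFloor_sub_le m s)
      Real.two_pi_pos.le).trans_eq (by ring)
  have hsum : ∑' m, P (bad m) ≠ ⊤ := by
    refine ne_top_of_le_ne_top ?_ (ENNReal.tsum_le_tsum hP)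
    exact ((summable_geometric_of_lt_one (by norm_num) (by norm_num)).mul_left
      (2 * (d : ℝ))).tsum_ofReal_ne_top
  filter_upwards [ae_eventually_notMem hsum,
    hY.ae_eventually_forall_norm_circlePath_sub_le hd hA ha] with ω hω ⟨m₀, hm₀⟩
  have h1 := tendsto_dyadicLimit (level_nonneg hK a) (summable_level hK ha) hm₀ s
  have h2 : Tendsto (fun m => circlePath Y ω (dyadicFloor m s)) atTop (𝓝 (Y x ω)) := by
    rw [tendsto_iff_norm_sub_tendsto_zero]
    refine squeeze_zero' (Eventually.of_forall fun m => norm_nonneg _) ?_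
      (summable_level hK ha).tendsto_atTop_zero
    filter_upwards [hω] with m hm
    exact not_lt.mp hm
  exact tendsto_nhds_unique h1 h2

end Random

/-! ### Path properties of fields on the circle -/

section Paths

variable {Ω E : Type*} [MeasurableSpace Ω] [NormedAddCommGroup E] {P : Measure Ω}
  {Y Z : Real.Angle → Ω → E} {α : ℝ}

theorem rpow_mul_sqrt_log_le {a b r : ℝ} (hab : b < a) (hr : 0 < r) :
    r ^ a * √(Real.log (1 / r)) ≤ (√(2 * (a - b)))⁻¹ * r ^ b := by
  have h0 : 0 < 2 * (a - b) := by linarith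
  have h1 : Real.log (1 / r) ≤ ((1 / r) ^ (a - b)) ^ 2 / (2 * (a - b)) := by
    have := Real.log_le_rpow_div (x := 1 / r) (by positivity) h0
    rwa [← Real.rpow_natCast, ← Real.rpow_mul (by positivity), Nat.cast_ofNat, mul_comm (a - b)]
  have h2 : √(Real.log (1 / r)) ≤ (1 / r) ^ (a - b) / √(2 * (a - b)) := by
    refine (Real.sqrt_le_sqrt h1).trans_eq ?_
    rw [Real.sqrt_div (by positivity), Real.sqrt_sq (by positivity)]
  calc _ ≤ r ^ a * ((1 / r) ^ (a - b) / √(2 * (a - b))) := by gcongr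
    _ = (√(2 * (a - b)))⁻¹ * (r ^ a * (1 / r) ^ (a - b)) := by ring
    _ = _ := by
        congr 1
        rw [one_div, Real.inv_rpow hr.le, ← Real.rpow_neg hr.le, ← Real.rpow_add hr]
        congr 1; ring

theorem continuous_of_forall_norm_sub_le {f : Real.Angle → E} {b M ε : ℝ} (hb : 0 < b)
    (hε : 0 < ε) (h : ∀ x y, ‖x - y‖ < ε → ‖f x - f y‖ ≤ M * ‖x - y‖ ^ b) : Continuous f := by
  refine continuous_iff_continuousAt.mpr fun x => ?_
  rw [ContinuousAt, tendsto_iff_norm_sub_tendsto_zero]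
  have h1 : Tendsto (fun y : Real.Angle => ‖y - x‖) (𝓝 x) (𝓝 0) :=
    tendsto_iff_norm_sub_tendsto_zero.mp tendsto_id
  have h2 : Tendsto (fun y : Real.Angle => M * ‖y - x‖ ^ b) (𝓝 x) (𝓝 0) := by
    have := (h1.rpow_const (Or.inr hb.le)).const_mul M
    rwa [Real.zero_rpow hb.ne', mul_zero] at this
  refine squeeze_zero' (Eventually.of_forall fun y => norm_nonneg _) ?_ h2
  filter_upwards [h1.eventually_lt_const hε] with y hy
  exact h y x hy

/-- A local Hölder bound on the circle is global, by compactness. -/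
theorem exists_forall_norm_sub_le_of_local {f : Real.Angle → E} {b M ε : ℝ} (hb : 0 < b)
    (hε : 0 < ε) (h : ∀ x y, ‖x - y‖ < ε → ‖f x - f y‖ ≤ M * ‖x - y‖ ^ b) :
    ∃ M', ∀ x y, ‖f x - f y‖ ≤ M' * ‖x - y‖ ^ b := by
  have : Fact (0 < 2 * Real.pi) := ⟨Real.two_pi_pos⟩
  have : CompactSpace Real.Angle := inferInstanceAs (CompactSpace (AddCircle (2 * Real.pi)))
  obtain ⟨S, hS⟩ := isCompact_univ.exists_bound_of_continuousOn
    (continuous_of_forall_norm_sub_le hb hε h).continuousOn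
  have hS0 : 0 ≤ S := (norm_nonneg _).trans (hS 0 (Set.mem_univ _))
  refine ⟨max M (2 * S / ε ^ b), fun x y => ?_⟩
  rcases lt_or_ge ‖x - y‖ ε with h1 | h1
  · exact (h x y h1).trans (by gcongr; exact le_max_left _ _)
  · have h2 : ε ^ b ≤ ‖x - y‖ ^ b := Real.rpow_le_rpow hε.le h1 hb.le
    calc ‖f x - f y‖ ≤ ‖f x‖ + ‖f y‖ := norm_sub_le _ _
      _ ≤ 2 * S := by linarith [hS x (Set.mem_univ _), hS y (Set.mem_univ _)]
      _ = 2 * S / ε ^ b * ε ^ b := by field_simp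
      _ ≤ max M (2 * S / ε ^ b) * ‖x - y‖ ^ b := by gcongr; exact le_max_right _ _

theorem holderBelow_of_forall_hasUniformModulus (hα : 0 < α)
    (h : ∀ a, 0 < a → a < α → HasUniformModulus P Y (fun r => r ^ a * √(Real.log (1 / r)))) :
    HolderBelow P Y α := by
  have hae : ∀ᵐ ω ∂P, ∀ n : ℕ, ∃ K : ℝ, 0 < K ∧ ∃ ε : ℝ, 0 < ε ∧
      ∀ x y, 0 < ‖x - y‖ → ‖x - y‖ < ε → ‖Y x ω - Y y ω‖ ≤
        K * (‖x - y‖ ^ (α * (1 - 1 / ((n : ℝ) + 2))) * √(Real.log (1 / ‖x - y‖))) := by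
    rw [ae_all_iff]
    intro n
    have hn : 1 / ((n : ℝ) + 2) < 1 := by
      rw [div_lt_one (by positivity)]; linarith [n.cast_nonneg (α := ℝ)]
    have hn0 : 0 < 1 / ((n : ℝ) + 2) := by positivity
    obtain ⟨K, hK, hKae⟩ := h (α * (1 - 1 / ((n : ℝ) + 2))) (mul_pos hα (by linarith))
      (by nlinarith)
    filter_upwards [hKae] with ω hω
    exact ⟨K, hK, hω⟩
  filter_upwards [hae] with ω hω b hb hbα
  obtain ⟨n, hn⟩ := exists_nat_gt (α / (α - b))
  have hba : b < α * (1 - 1 / ((n : ℝ) + 2)) := by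
    rw [div_lt_iff₀ (by linarith)] at hn
    rw [mul_sub, mul_one, mul_one_div, lt_sub_comm, div_lt_iff₀ (by positivity)]
    nlinarith
  obtain ⟨K, hK, ε, hε, hmod⟩ := hω n
  refine exists_forall_norm_sub_le_of_local hb hε
    (M := K * (√(2 * (α * (1 - 1 / ((n : ℝ) + 2)) - b)))⁻¹) fun x y hxy => ?_
  rcases (norm_nonneg (x - y)).eq_or_lt with h0 | h0
  · have : x = y := sub_eq_zero.mp (norm_eq_zero.mp h0.symm)
    subst this
    simp [Real.zero_rpow hb.ne']
  · rw [mul_assoc]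
    exact (hmod x y h0 hxy).trans (mul_le_mul_of_nonneg_left
      (rpow_mul_sqrt_log_le hba h0) hK.le)

/-- A separable field coincides with any modification of it that has continuous paths. -/
theorem IsSeparableField.ae_forall_eq (hY : IsSeparableField P Y) (hα : 0 < α)
    (hZ : HolderBelow P Z α) (h : ∀ x, Z x =ᵐ[P] Y x) : ∀ᵐ ω ∂P, ∀ x, Z x ω = Y x ω := by
  obtain ⟨D, hD, -, hsep⟩ := hY
  filter_upwards [hsep, hZ, (ae_ball_iff hD).mpr fun x _ => h x] with ω h1 h2 h3 x
  obtain ⟨M, hM⟩ := h2 (α / 2) (by linarith) (by linarith)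
  have hcont : Continuous fun x => Z x ω :=
    continuous_of_forall_norm_sub_le (half_pos hα) one_pos fun x y _ => hM x y
  have hclosed : IsClosed {p : Real.Angle × E | Z p.1 ω = p.2} :=
    isClosed_eq (hcont.comp continuous_fst) continuous_snd
  refine hclosed.closure_subset_iff.mpr ?_ (h1 x)
  rintro _ ⟨y, hy, rfl⟩
  exact h3 y hy

theorem HolderBelow.congr (hZ : HolderBelow P Z α) (h : ∀ᵐ ω ∂P, ∀ x, Z x ω = Y x ω) :
    HolderBelow P Y α := by
  filter_upwards [hZ, h] with ω h1 h2
  simpa only [h2] using h1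

theorem HasUniformModulus.congr {w : ℝ → ℝ} (hZ : HasUniformModulus P Z w)
    (h : ∀ᵐ ω ∂P, ∀ x, Z x ω = Y x ω) : HasUniformModulus P Y w := by
  obtain ⟨K, hK, hae⟩ := hZ
  refine ⟨K, hK, ?_⟩
  filter_upwards [hae, h] with ω h1 h2
  simpa only [h2] using h1

end Paths

/-! ### The canonical metric and the sample paths of the solution -/

section Assembly

variable {Ω : Type*} [MeasurableSpace Ω] {P : Measure Ω} {d : ℕ}
  {Y : Real.Angle → Ω → EuclideanSpace ℝ (Fin d)} {w : ℕ → ℝ} {A B a α : ℝ}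

theorem IncrementLaw.canonicalMetric_eq (hY : IncrementLaw P Y w) (x y : Real.Angle) :
    canonicalMetric P Y x y = √(d * ∑' n : ℕ, w n * (1 - Real.cos (n * ‖x - y‖))) := by
  rw [canonicalMetric, hY.integral_norm_sub_sq]

theorem sqrt_mul_rpow_eq {X r : ℝ} (hX : 0 ≤ X) (hr : 0 ≤ r) (a : ℝ) :
    √X * r ^ a = √(X * r ^ (2 * a)) := by
  rw [Real.sqrt_mul hX, mul_comm 2 a, Real.rpow_mul hr, Real.rpow_two,
    Real.sqrt_sq (by positivity)]

theorem eventually_norm_coe_eq : ∀ᶠ r : ℝ in 𝓝[>] 0, ‖(r : Real.Angle)‖ = r := by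
  filter_upwards [Ioo_mem_nhdsGT Real.pi_pos] with r hr
  rw [Real.Angle.norm_eq_abs_toReal,
    Real.Angle.toReal_coe_eq_self_iff.mpr ⟨by linarith [hr.1, Real.pi_pos], hr.2.le⟩,
    abs_of_pos hr.1]

theorem IncrementLaw.exists_subgaussianIncrements (hY : IncrementLaw P Y w) (hw : ∀ n, 0 ≤ w n)
    (ha : 0 < a) (ha1 : a < 1) (haα : a ≤ α) (hB0 : 0 < B)
    (hB : ∀ᶠ n : ℕ in atTop, w n ≤ B * (n : ℝ) ^ (-(2 * α) - 1)) :
    ∃ A : ℝ, 0 < A ∧ SubgaussianIncrements P Y A a := by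
  have hB' : ∀ᶠ n : ℕ in atTop, w n ≤ B * (n : ℝ) ^ (-(2 * a) - 1) := by
    filter_upwards [hB, eventually_ge_atTop 1] with n hn hn1
    refine hn.trans ?_
    have : (1 : ℝ) ≤ n := by exact_mod_cast hn1
    gcongr
  obtain ⟨A, hA, hAle⟩ := exists_tsum_mul_one_sub_cos_le hw ha ha1 hB0 hB'
  refine ⟨A, hA, fun x y i => (hY.subgaussian x y i).mono (Real.toNNReal_le_toNNReal ?_)⟩
  rw [← (hY.hasSum x y i).tsum_eq]
  exact hAle _ (norm_nonneg _)

end Assembly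

theorem corollary2p2 :
    ∃ k K : ℝ → ℝ, (∀ a, 0 < k a) ∧ (∀ a, 0 < K a) ∧
    ∀ d : ℕ, 1 ≤ d →
    ∃ c₀ C₀ : ℝ → ℝ → ℝ → ℝ, (∀ t₀ T H, 0 < c₀ t₀ T H) ∧ (∀ t₀ T H, 0 < C₀ t₀ T H) ∧
    ∀ H : ℝ, 0 < H → H < 1 →
    ∀ (t₀ T : ℝ) (t : ℝ≥0), 0 < t₀ → t₀ ≤ t → t ≤ T →
    ∀ (q : ℕ → ℝ) (c C α : ℝ), NoiseHypothesis H q c C α →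
    ∀ (Ω : Type*) [MeasurableSpace Ω] (P : Measure Ω) [IsProbabilityMeasure P]
      (W : Fin d → ℕ → Fin 2 → ℝ≥0 → Ω → ℝ) (_ : IsFBMFamily P H W)
      (u : ℝ≥0 → Real.Angle → Ω → EuclideanSpace ℝ (Fin d)) (_ : IsMildSolution P q W u),
    (∃ δ : Real.Angle → ℝ,
      (∀ x y, canonicalMetric P (u t) x y = δ (x - y)) ∧
      (∀ᶠ r : ℝ in 𝓝[>] 0, √(k α * c * c₀ t₀ T H) * r ^ α ≤ δ (r : Real.Angle)) ∧
      (α < 1 → ∀ᶠ r : ℝ in 𝓝[>] 0, δ (r : Real.Angle) ≤ √(K α * C * C₀ t₀ T H) * r ^ α)) ∧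
    (∃ v : Real.Angle → Ω → EuclideanSpace ℝ (Fin d),
      (∀ x, v x =ᵐ[P] u t x) ∧
      HolderBelow P v α ∧
      (α < 1 → HasUniformModulus P v (fun r => r ^ α * √(Real.log (1 / r))))) ∧
    (IsSeparableField P (u t) →
      HolderBelow P (u t) α ∧
      (α < 1 → HasUniformModulus P (u t) (fun r => r ^ α * √(Real.log (1 / r))))) := by
  classical
  refine ⟨lowerConst, fun a => if 0 < a ∧ a < 1 then 2 * upperConst a else 1, lowerConst_pos,
    fun a => ?_, fun d hd => ?_⟩
  · dsimp only
    split_ifs with h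
    · exact mul_pos two_pos (upperConst_pos h.1 h.2)
    · exact one_pos
  have hd0 : (0 : ℝ) < d := by exact_mod_cast hd
  refine ⟨fun t₀ _ H => if 0 < t₀ then d * (t₀ ^ (2 * H) * Real.exp (-4 * t₀)) else 1,
    fun _ _ _ => 32 * d, fun t₀ T H => ?_, fun _ _ _ => by positivity, ?_⟩
  · dsimp only
    split_ifs with h
    · positivity
    · exact one_pos
  intro H hH hH1 t₀ T t ht₀ ht _ q c C α hq Ω _ P _ W hW u hu
  obtain ⟨w, hw, hwl, hwu, hY⟩ := hu.exists_incrementLaw hq.nonneg hW hH hH1 hd ht₀ ht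
  have hα := hq.α_pos
  have hc := hq.c_pos
  have hC := hq.C_pos
  have hexp : ∀ n : ℕ, n ≠ 0 → (n : ℝ) ^ (4 * H - 2 * α - 1) * (n : ℝ) ^ (-(4 * H)) =
      (n : ℝ) ^ (-(2 * α) - 1) := by
    intro n hn
    rw [← Real.rpow_add (by exact_mod_cast Nat.pos_of_ne_zero hn)]
    congr 1; ring
  have hlow : ∀ᶠ n : ℕ in atTop,
      t₀ ^ (2 * H) * Real.exp (-4 * t₀) * c * (n : ℝ) ^ (-(2 * α) - 1) ≤ w n := by
    filter_upwards [hq.bounds, eventually_ne_atTop 0] with n hn hn0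
    refine le_trans ?_ (hwl n hn0)
    rw [← hexp n hn0, mul_assoc _ c, ← mul_assoc c]
    gcongr
    exact hn.1
  have hupp : ∀ᶠ n : ℕ in atTop, w n ≤ 32 * C * (n : ℝ) ^ (-(2 * α) - 1) := by
    filter_upwards [hq.bounds, eventually_ne_atTop 0] with n hn hn0
    refine (hwu n hn0).trans ?_
    rw [← hexp n hn0, mul_assoc _ C, ← mul_assoc C]
    gcongr
    exact hn.2
  have hs := summable_of_eventually_le hw hα hupp
  have hsub : ∀ a, 0 < a → a < 1 → a ≤ α → ∃ A : ℝ, 0 < A ∧ SubgaussianIncrements P (u t) A a :=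
    fun a ha ha1 haα => hY.exists_subgaussianIncrements hw ha ha1 haα (by positivity) hupp
  have hmod : ∀ a, 0 < a → a < 1 → a ≤ α →
      HasUniformModulus P (dyadicVersion (u t)) (fun r => r ^ a * √(Real.log (1 / r))) := by
    intro a ha ha1 haα
    obtain ⟨A, hA, hAsub⟩ := hsub a ha ha1 haα
    exact hAsub.hasUniformModulus_dyadicVersion hd hA ha
  have hHolder : HolderBelow P (dyadicVersion (u t)) α :=
    holderBelow_of_forall_hasUniformModulus hα fun a ha haα =>
      hmod a ha (haα.trans_le hq.α_le_one) haα.le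
  have hver : ∀ x, dyadicVersion (u t) x =ᵐ[P] u t x := by
    obtain ⟨A, hA, hAsub⟩ := hsub (α / 2) (by linarith) (by linarith [hq.α_le_one]) (by linarith)
    exact hAsub.dyadicVersion_ae_eq hd hA (by linarith)
  refine ⟨⟨fun z => √(d * ∑' n : ℕ, w n * (1 - Real.cos (n * ‖z‖))), hY.canonicalMetric_eq, ?_, ?_⟩,
    ⟨dyadicVersion (u t), hver, hHolder, fun hα1 => hmod α hα hα1 le_rfl⟩, fun hsep => ?_⟩
  · filter_upwards [eventually_le_tsum_mul_one_sub_cos hw hs hα (by positivity) hlow,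
      eventually_norm_coe_eq, self_mem_nhdsWithin] with r hr hnorm hr0
    have hr0' : 0 < r := hr0
    have := lowerConst_pos α
    rw [if_pos ht₀, hnorm, sqrt_mul_rpow_eq (by positivity) hr0'.le]
    refine Real.sqrt_le_sqrt ?_
    refine le_trans (le_of_eq ?_) (mul_le_mul_of_nonneg_left hr hd0.le)
    ring
  · intro hα1
    filter_upwards [eventually_tsum_mul_one_sub_cos_le hw hα hα1 (by positivity) hupp,
      eventually_norm_coe_eq, self_mem_nhdsWithin] with r hr hnorm hr0
    have hr0' : 0 < r := hr0
    have := upperConst_pos hα hα1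
    rw [if_pos ⟨hα, hα1⟩, hnorm, sqrt_mul_rpow_eq (by positivity) hr0'.le]
    refine Real.sqrt_le_sqrt ?_
    refine (mul_le_mul_of_nonneg_left hr hd0.le).trans (le_of_eq ?_)
    ring
  · have heq := hsep.ae_forall_eq hα hHolder hver
    exact ⟨hHolder.congr heq, fun hα1 => (hmod α hα hα1 le_rfl).congr heq⟩
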